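/- Let $L$ be a many-sorted first-order language whose only symbols are constant symbols and relation symbols, and which is \emph{local}: for each single sort $s$ a partially ordered monoid $D^s$ of binary relation symbols on $s$ (the locality symbols) is distinguished, whose identity is the equality symbol of $s$ and is also its least element; and to any two constant symbols $c_1,c_2$ of the same sort a locality symbol $B_{c_1,c_2}$ on that sort is assigned. All sorts of an $L$-structure are nonempty. An $L$-structure $M$ is \emph{local} if every locality symbol is interpreted as a symmetric relation; $d_1\le d_2$ implies $d_1^M\subseteq d_2^M$; $d_1^M\circ d_2^M\subseteq (d_1*d_2)^M$; $B_{c_1,c_2}(c_1,c_2)$ holds for all constant symbols $c_1,c_2$ of the same sort; and any two elements $a,b$ of the same sort satisfy $d(a,b)$ for some locality symbol $d$. Write $|M|$ for the total number of elements of $M$ over all sorts, and $|L|$ for the number of symbols of $L$. Positive formulas are those built from atomic formulas by conjunctions, disjunctions and existential quantifiers; negative formulas are their negations. Let $T$ be a negative local theory, i.e. a set of negative sentences containing every negative sentence that holds in all local models of $T$ (local structures satisfying $T$). A homomorphism $f\colon A\to B$ of $L$-structures is a \emph{positive embedding} if $B\models\varphi(f(a))$ implies $A\models\varphi(a)$ for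 every positive formula $\varphi(x)$ and every tuple $a$ of $A$. A \emph{local positively closed model} of $T$ is a local model $M$ of $T$ such that every homomorphism from $M$ to a local model of $T$ is a positive embedding. For a cardinal $\kappa$, a local model $M$ of $T$ is \emph{$\kappa$-ultrahomogeneous} for $T$ if, for every positive embedding $f\colon A\to M$ and every homomorphism $g\colon A\to B$ to a local model $B$ of $T$ with $|A|,|B|<\kappa$, there is a homomorphism $h\colon B\to M$ with $f=h\circ g$. Then, for every local model $N$ of $T$ and every cardinal $\kappa$, there is a homomorphism from $N$ to a $\kappa$-ultrahomogeneous local positively closed model $M$ of $T$. Moreover, if $\kappa$ is infinite, $|L|\le\kappa$ and $|N|\le\kappa$, then $M$ can be chosen with $|M|\le 2^{\kappa}$. -/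

import Mathlib

open Cardinal

universe u

/-- A many-sorted local first-order language: constant symbols and relation symbols only.
The locality relation symbols on a sort `s` are the elements of `Loc s`, which is a partially
ordered monoid (not assumed commutative) whose identity `1` is the equality symbol of the sort `s`
and is its least element. The relation symbols which are not locality relation symbols are the
elements of `Rel l`, where the list `l` of single sorts is the sort of the symbol. -/
structure LocalLanguage where
  /-- The single sorts. -/
  Sorts : Type u
  /-- The constant symbols of each single sort. -/
  Const : Sorts → Type u
  /-- The relation symbols, other than the locality relation symbols, of each sort. -/
  Rel : List Sorts → Type u
  /-- The locality relation symbols on each single sort, equality (`1`) included. -/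
  Loc : Sorts → Type u
  [locMonoid : ∀ s, Monoid (Loc s)]
  [locOrder : ∀ s, PartialOrder (Loc s)]
  mul_le_mul_loc : ∀ {s : Sorts} (d₁ d₂ e₁ e₂ : Loc s), d₁ ≤ d₂ → e₁ ≤ e₂ → d₁ * e₁ ≤ d₂ * e₂
  one_le_loc : ∀ {s : Sorts} (d : Loc s), 1 ≤ d
  /-- The bound function. -/
  bound : ∀ {s : Sorts}, Const s → Const s → Loc s

namespace LocalLanguage

attribute [instance] LocalLanguage.locMonoid LocalLanguage.locOrder

/-- The cardinality of the set of symbols of `L`. (There are at most that many sorts, because there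
is an equality symbol on every sort.) -/
def card (L : LocalLanguage.{u}) : Cardinal.{u} :=
  #((Σ s, L.Const s) ⊕ (Σ l, L.Rel l) ⊕ (Σ s, L.Loc s))

/-! ### Structures and homomorphisms -/

/-- An arbitrary (not necessarily local) `L`-structure. As usual in first-order logic, every sort is
nonempty and equality is interpreted as equality. -/
structure Struc (L : LocalLanguage.{u}) where
  /-- The universe of each sort. -/
  carrier : L.Sorts → Type u
  nonempty_carrier : ∀ s, Nonempty (carrier s)
  /-- Interpretation of the constant symbols. -/
  constMap : ∀ {s : L.Sorts}, L.Const s → carrier s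
  /-- Interpretation of the relation symbols other than the locality relation symbols. -/
  relMap : ∀ {l : List L.Sorts}, L.Rel l → (∀ i : Fin l.length, carrier (l.get i)) → Prop
  /-- Interpretation of the locality relation symbols. -/
  locMap : ∀ {s : L.Sorts}, L.Loc s → carrier s → carrier s → Prop
  locMap_one : ∀ {s : L.Sorts} (a b : carrier s), locMap 1 a b ↔ a = b

variable {L : LocalLanguage.{u}}

/-- The size `|M|`: the total number of elements of `M`, over all sorts. -/
def Struc.card (M : L.Struc) : Cardinal.{u} := #(Σ s, M.carrier s)

/-- The locality axioms. -/
structure Struc.IsLocal (M : L.Struc) : Prop where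
  symm : ∀ {s : L.Sorts} (d : L.Loc s) (a b : M.carrier s), M.locMap d a b → M.locMap d b a
  mono : ∀ {s : L.Sorts} (d₁ d₂ : L.Loc s), d₁ ≤ d₂ →
    ∀ a b : M.carrier s, M.locMap d₁ a b → M.locMap d₂ a b
  comp : ∀ {s : L.Sorts} (d₁ d₂ : L.Loc s) (a b c : M.carrier s),
    M.locMap d₁ a b → M.locMap d₂ b c → M.locMap (d₁ * d₂) a c
  bound : ∀ {s : L.Sorts} (c₁ c₂ : L.Const s),
    M.locMap (L.bound c₁ c₂) (M.constMap c₁) (M.constMap c₂)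
  exists_loc : ∀ {s : L.Sorts} (a b : M.carrier s), ∃ d : L.Loc s, M.locMap d a b

/-- Homomorphisms of `L`-structures. -/
structure Hom (A B : L.Struc) where
  toFun : ∀ {s : L.Sorts}, A.carrier s → B.carrier s
  map_const : ∀ {s : L.Sorts} (c : L.Const s), toFun (A.constMap c) = B.constMap c
  map_rel : ∀ {l : List L.Sorts} (r : L.Rel l) (x : ∀ i : Fin l.length, A.carrier (l.get i)),
    A.relMap r x → B.relMap r (fun i => toFun (x i))
  map_loc : ∀ {s : L.Sorts} (d : L.Loc s) (a b : A.carrier s),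
    A.locMap d a b → B.locMap d (toFun a) (toFun b)

/-! ### Formulas -/

/-- A single variable: its sort and its name. There are countably many on every sort. -/
abbrev Var (L : LocalLanguage.{u}) : Type u := L.Sorts × ℕ

/-- The terms of sort `s`. -/
inductive Term (L : LocalLanguage.{u}) (s : L.Sorts) : Type u
  | var (n : ℕ) : Term L s
  | const (c : L.Const s) : Term L s

/-- First-order formulas. The atomic formulas are `loc d t₁ t₂` (which is `t₁ = t₂` for `d = 1`)
and `rel r t`. -/
inductive Formula (L : LocalLanguage.{u}) : Type u
  | loc {s : L.Sorts} (d : L.Loc s) (t₁ t₂ : L.Term s) : Formula L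
  | rel {l : List L.Sorts} (r : L.Rel l) (t : ∀ i : Fin l.length, L.Term (l.get i)) : Formula L
  | neg (φ : Formula L) : Formula L
  | and (φ ψ : Formula L) : Formula L
  | or (φ ψ : Formula L) : Formula L
  | ex (x : L.Var) (φ : Formula L) : Formula L

/-- The variables of a term. -/
def Term.vars {s : L.Sorts} : L.Term s → Set L.Var
  | .var n => {(s, n)}
  | .const _ => ∅

/-- The free variables of a formula. -/
def Formula.freeVars : L.Formula → Set L.Var
  | .loc _ t₁ t₂ => t₁.vars ∪ t₂.vars
  | .rel _ t => ⋃ i, (t i).vars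
  | .neg φ => φ.freeVars
  | .and φ ψ => φ.freeVars ∪ ψ.freeVars
  | .or φ ψ => φ.freeVars ∪ ψ.freeVars
  | .ex x φ => φ.freeVars \ {x}

/-- A sentence is a formula without free variables. -/
def Formula.IsSentence (φ : L.Formula) : Prop := φ.freeVars = ∅

/-- Positive formulas: built from atomic formulas by conjunctions, disjunctions and existential
quantifiers. -/
inductive Formula.IsPositive : L.Formula → Prop
  | loc {s : L.Sorts} (d : L.Loc s) (t₁ t₂ : L.Term s) : IsPositive (.loc d t₁ t₂)
  | rel {l : List L.Sorts} (r : L.Rel l) (t : ∀ i : Fin l.length, L.Term (l.get i)) :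
      IsPositive (.rel r t)
  | and {φ ψ : L.Formula} : IsPositive φ → IsPositive ψ → IsPositive (.and φ ψ)
  | or {φ ψ : L.Formula} : IsPositive φ → IsPositive ψ → IsPositive (.or φ ψ)
  | ex (x : L.Var) {φ : L.Formula} : IsPositive φ → IsPositive (.ex x φ)

/-- Negative formulas: the negations of positive formulas. -/
def Formula.IsNegative (φ : L.Formula) : Prop := ∃ ψ : L.Formula, ψ.IsPositive ∧ φ = .neg ψ

/-- Assignments of the variables in a structure. -/
abbrev Struc.Assignment (M : L.Struc) : Type u := ∀ x : L.Var, M.carrier x.1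

/-- The value of a term under an assignment. -/
def Term.value (M : L.Struc) (v : M.Assignment) {s : L.Sorts} : L.Term s → M.carrier s
  | .var n => v (s, n)
  | .const c => M.constMap c

open Classical in
/-- `φ.Realize M v`: the formula `φ` holds in `M` under the assignment `v`. -/
def Formula.Realize (M : L.Struc) : L.Formula → M.Assignment → Prop
  | .loc d t₁ t₂, v => M.locMap d (t₁.value M v) (t₂.value M v)
  | .rel r t, v => M.relMap r (fun i => (t i).value M v)
  | .neg φ, v => ¬ φ.Realize M v
  | .and φ ψ, v => φ.Realize M v ∧ ψ.Realize M v
  | .or φ ψ, v => φ.Realize M v ∨ ψ.Realize M v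
  | .ex x φ, v => ∃ a : M.carrier x.1, φ.Realize M (Function.update v x a)

/-- Satisfaction of a sentence in an arbitrary structure. -/
def Struc.Satisfies (M : L.Struc) (φ : L.Formula) : Prop := ∀ v : M.Assignment, φ.Realize M v

/-- `M ⊨ T`: `M` is a local structure satisfying every sentence of `T`. -/
def Struc.IsLocalModel (M : L.Struc) (T : Set L.Formula) : Prop :=
  M.IsLocal ∧ ∀ φ ∈ T, M.Satisfies φ

/-- A negative local theory: a set of negative sentences closed under local implication. -/
structure IsNegativeLocalTheory (T : Set L.Formula) : Prop where
  isSentence : ∀ φ ∈ T, φ.IsSentence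
  isNegative : ∀ φ ∈ T, φ.IsNegative
  closed : ∀ φ : L.Formula, φ.IsSentence → φ.IsNegative →
    (∀ M : L.Struc, M.IsLocalModel T → M.Satisfies φ) → φ ∈ T

/-- Positive embeddings: homomorphisms which reflect all positive formulas. -/
def Hom.IsPositiveEmbedding {A B : L.Struc} (f : Hom A B) : Prop :=
  ∀ φ : L.Formula, φ.IsPositive → ∀ v : A.Assignment,
    φ.Realize B (fun x => f.toFun (v x)) → φ.Realize A v

/-- `M` is a local positively closed model of `T`: a local model of `T` such that every homomorphism
from `M` to a local model of `T` is a positive embedding. -/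
def Struc.IsLocalPCModel (M : L.Struc) (T : Set L.Formula) : Prop :=
  M.IsLocalModel T ∧
    ∀ B : L.Struc, B.IsLocalModel T → ∀ f : Hom M B, f.IsPositiveEmbedding

/-- `M` is a local positively `κ`-ultrahomogeneous model of `T`. -/
def Struc.IsUltrahomogeneous (M : L.Struc) (T : Set L.Formula) (κ : Cardinal.{u}) : Prop :=
  M.IsLocalModel T ∧
    ∀ (A B : L.Struc) (f : Hom A M) (g : Hom A B), f.IsPositiveEmbedding → B.IsLocalModel T →
      A.card < κ → B.card < κ →
        ∃ h : Hom B M, ∀ (s : L.Sorts) (a : A.carrier s), f.toFun a = h.toFun (g.toFun a)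

end LocalLanguage

/-! First enlarge `κ` so that it also bounds `|L|` and `|N|`. The model is then the direct limit of
a chain of local models of `T` that starts with `N`, is indexed by the initial ordinal of `2 ^ κ`,
and gains at most `κ` new names per step. Each step solves one extension problem, of one of two
kinds: make a positive formula true if it is true in some local model of `T` further up
(`Named.exists_decides`), or adjoin a homomorphic copy of a small model over prescribed parameters
(`Named.exists_absorbs`). There are at most `2 ^ κ` problems, and each is posed cofinally often. By
König's theorem the length has cofinality above `κ`, so any `κ` elements of the limit occur together
at one stage, and every problem about them is solved at a later one. Problems of the first kind make
the limit positively closed, those of the second make it ultrahomogeneous.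

Compactness fails for local models, so amalgamation (`exists_amalgam`) needs care. If the positive
type of the parameters in `A` is contained in that in `B`, finitely many facts about `A` can be
satisfied in `B`, hence all of them in an ultrapower of `B`. As every element of `A` is at bounded
distance from a parameter, the images stay in the part of the ultrapower at bounded distance from
`B`. That part is local, and it satisfies `T` because `T` is negative.

Direct limits need no such care (`Named.exists_limit`): a positive formula true in the limit is true
at some stage, so negative sentences survive.

All elements carry names from a fixed set, and the maps preserve names. The problems are thus stated
in advance as data on names, which allows counting them, and the names bound the size of the limit.
-/

namespace LocalLanguage

variable {L : LocalLanguage.{u}}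

/-! ### Homomorphisms and positive formulas -/

/-- The identity homomorphism. -/
def Hom.id (A : L.Struc) : Hom A A where
  toFun := fun a => a
  map_const := fun _ => rfl
  map_rel := fun _ _ h => h
  map_loc := fun _ _ _ h => h

/-- Composition of homomorphisms. -/
def Hom.comp {A B C : L.Struc} (g : Hom B C) (f : Hom A B) : Hom A C where
  toFun := fun a => g.toFun (f.toFun a)
  map_const := fun c => by rw [f.map_const, g.map_const]
  map_rel := fun r x h => g.map_rel r _ (f.map_rel r x h)
  map_loc := fun d a b h => g.map_loc d _ _ (f.map_loc d a b h)

theorem Hom.map_value {A B : L.Struc} (f : Hom A B) (v : A.Assignment) {s : L.Sorts}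
    (t : L.Term s) : t.value B (fun x => f.toFun (v x)) = f.toFun (t.value A v) := by
  cases t with
  | var n => rfl
  | const c => exact (f.map_const c).symm

theorem Formula.realize_ex {M : L.Struc} {x : L.Var} {φ : L.Formula} {v : M.Assignment} :
    (Formula.ex x φ).Realize M v ↔
      ∃ w : M.Assignment, (∀ y, y ≠ x → w y = v y) ∧ φ.Realize M w := by
  classical
  constructor
  · rintro ⟨a, ha⟩
    exact ⟨_, fun y hy => Function.update_of_ne hy _ _, ha⟩
  · rintro ⟨w, hw, h⟩
    refine ⟨w x, ?_⟩
    convert h using 1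
    funext y
    by_cases hy : y = x
    · subst hy
      simp
    · rw [Function.update_of_ne hy, hw y hy]

theorem Hom.realize {A B : L.Struc} (f : Hom A B) {φ : L.Formula} (hφ : φ.IsPositive) :
    ∀ v : A.Assignment, φ.Realize A v → φ.Realize B (fun x => f.toFun (v x)) := by
  induction hφ with
  | loc d t₁ t₂ =>
    intro v h
    simp only [Formula.Realize, f.map_value]
    exact f.map_loc d _ _ h
  | rel r t =>
    intro v h
    simp only [Formula.Realize, f.map_value]
    exact f.map_rel r _ h
  | and _ _ ih₁ ih₂ => exact fun v h => ⟨ih₁ v h.1, ih₂ v h.2⟩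
  | or _ _ ih₁ ih₂ => exact fun v h => h.imp (ih₁ v) (ih₂ v)
  | ex x _ ih =>
    intro v h
    obtain ⟨w, hw, h⟩ := Formula.realize_ex.1 h
    exact Formula.realize_ex.2 ⟨_, fun y hy => by rw [hw y hy], ih w h⟩

theorem Term.value_congr {M : L.Struc} {v w : M.Assignment} {s : L.Sorts} (t : L.Term s)
    (h : ∀ x ∈ t.vars, v x = w x) : t.value M v = t.value M w := by
  cases t with
  | var n => exact h (s, n) rfl
  | const c => rfl

theorem Formula.realize_congr {M : L.Struc} (φ : L.Formula) :
    ∀ v w : M.Assignment, (∀ x ∈ φ.freeVars, v x = w x) → (φ.Realize M v ↔ φ.Realize M w) := by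
  induction φ with
  | loc d t₁ t₂ =>
    intro v w h
    simp only [Formula.Realize]
    rw [t₁.value_congr fun x hx => h x (Or.inl hx), t₂.value_congr fun x hx => h x (Or.inr hx)]
  | rel r t =>
    intro v w h
    simp only [Formula.Realize]
    rw [show (fun i => (t i).value M v) = fun i => (t i).value M w from
      funext fun i => (t i).value_congr fun x hx => h x (Set.mem_iUnion.2 ⟨i, hx⟩)]
  | neg φ ih => exact fun v w h => not_congr (ih v w h)
  | and φ ψ ih₁ ih₂ =>
    exact fun v w h => and_congr (ih₁ v w fun x hx => h x (Or.inl hx))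
      (ih₂ v w fun x hx => h x (Or.inr hx))
  | or φ ψ ih₁ ih₂ =>
    exact fun v w h => or_congr (ih₁ v w fun x hx => h x (Or.inl hx))
      (ih₂ v w fun x hx => h x (Or.inr hx))
  | ex x φ ih =>
    intro v w h
    classical
    refine exists_congr fun a => ih _ _ fun y hy => ?_
    by_cases hyx : y = x
    · subst hyx
      simp
    · rw [Function.update_of_ne hyx, Function.update_of_ne hyx]
      exact h y ⟨hy, hyx⟩

/-- A structure with a homomorphism to a model of a set of negative sentences is a model of it. -/
theorem Struc.IsLocal.isLocalModel {T : Set L.Formula} (hT : IsNegativeLocalTheory T)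
    {A B : L.Struc} (hA : A.IsLocal) (f : Hom A B) (hB : B.IsLocalModel T) :
    A.IsLocalModel T := by
  refine ⟨hA, fun φ hφ v => ?_⟩
  obtain ⟨ψ, hψ, rfl⟩ := hT.isNegative φ hφ
  exact fun h => hB.2 _ hφ _ (f.realize hψ v h)

/-! ### Induced substructures -/

/-- The substructure of `M` induced on a family of nonempty sets containing the constants. -/
def Struc.induced (M : L.Struc) (D : ∀ s, Set (M.carrier s)) (hD : ∀ s, (D s).Nonempty)
    (hc : ∀ {s : L.Sorts} (c : L.Const s), M.constMap c ∈ D s) : L.Struc where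
  carrier s := D s
  nonempty_carrier s := (hD s).to_subtype
  constMap c := ⟨M.constMap c, hc c⟩
  relMap r x := M.relMap r fun i => x i
  locMap d a b := M.locMap d a b
  locMap_one a b := by rw [M.locMap_one, Subtype.ext_iff]

/-- The inclusion of an induced substructure. -/
def Struc.inducedIncl (M : L.Struc) (D : ∀ s, Set (M.carrier s)) (hD : ∀ s, (D s).Nonempty)
    (hc : ∀ {s : L.Sorts} (c : L.Const s), M.constMap c ∈ D s) : Hom (M.induced D hD hc) M where
  toFun a := a.1
  map_const _ := rfl
  map_rel _ _ h := h
  map_loc _ _ _ h := h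

/-- Homomorphisms reflecting the atomic formulas. -/
structure Hom.IsEmbedding {A B : L.Struc} (f : Hom A B) : Prop where
  rel : ∀ {l : List L.Sorts} (r : L.Rel l) (x : ∀ i : Fin l.length, A.carrier (l.get i)),
    B.relMap r (fun i => f.toFun (x i)) → A.relMap r x
  loc : ∀ {s : L.Sorts} (d : L.Loc s) (a b : A.carrier s),
    B.locMap d (f.toFun a) (f.toFun b) → A.locMap d a b

theorem Struc.inducedIncl_isEmbedding (M : L.Struc) (D : ∀ s, Set (M.carrier s))
    (hD : ∀ s, (D s).Nonempty) (hc : ∀ {s : L.Sorts} (c : L.Const s), M.constMap c ∈ D s) :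
    (M.inducedIncl D hD hc).IsEmbedding :=
  ⟨fun _ _ h => h, fun _ _ _ h => h⟩

/-- The locality axioms are universal in the elements: the existential quantifier in the last one
ranges over symbols. They therefore pass to substructures. -/
theorem Struc.IsLocal.of_isEmbedding {A B : L.Struc} {f : Hom A B} (hf : f.IsEmbedding)
    (hB : B.IsLocal) : A.IsLocal where
  symm d a b h := hf.loc d _ _ (hB.symm d _ _ (f.map_loc d a b h))
  mono d₁ d₂ hd a b h := hf.loc d₂ _ _ (hB.mono d₁ d₂ hd _ _ (f.map_loc d₁ a b h))
  comp d₁ d₂ a b c h₁ h₂ :=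
    hf.loc _ _ _ (hB.comp d₁ d₂ _ _ _ (f.map_loc d₁ a b h₁) (f.map_loc d₂ b c h₂))
  bound c₁ c₂ := hf.loc _ _ _ (by rw [f.map_const, f.map_const]; exact hB.bound c₁ c₂)
  exists_loc a b := (hB.exists_loc (f.toFun a) (f.toFun b)).imp fun d h => hf.loc d _ _ h

/-- A positive formula which holds in `C` already holds in every substructure containing suitable
finitely many elements. -/
theorem Formula.IsPositive.exists_finite_witnesses {C : L.Struc} {φ : L.Formula}
    (hφ : φ.IsPositive) : ∀ w : C.Assignment, φ.Realize C w →
      ∃ F : Set (Σ s, C.carrier s), F.Finite ∧ ∀ (Y : L.Struc) (f : Hom Y C), f.IsEmbedding →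
        (∀ a ∈ F, ∃ y : Y.carrier a.1, f.toFun y = a.2) →
        ∀ v : Y.Assignment, (∀ x, f.toFun (v x) = w x) → φ.Realize Y v := by
  induction hφ with
  | loc d t₁ t₂ =>
    intro w h
    refine ⟨∅, Set.finite_empty, fun Y f hf _ v hv => hf.loc d _ _ ?_⟩
    obtain rfl : (fun x => f.toFun (v x)) = w := funext hv
    rwa [← f.map_value, ← f.map_value]
  | rel r t =>
    intro w h
    refine ⟨∅, Set.finite_empty, fun Y f hf _ v hv => hf.rel r _ ?_⟩
    obtain rfl : (fun x => f.toFun (v x)) = w := funext hv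
    simp only [← f.map_value]
    exact h
  | and _ _ ih₁ ih₂ =>
    intro w h
    obtain ⟨F, hF, h₁⟩ := ih₁ w h.1
    obtain ⟨G, hG, h₂⟩ := ih₂ w h.2
    exact ⟨F ∪ G, hF.union hG, fun Y f hf hr v hv =>
      ⟨h₁ Y f hf (fun a ha => hr a (Or.inl ha)) v hv,
        h₂ Y f hf (fun a ha => hr a (Or.inr ha)) v hv⟩⟩
  | or _ _ ih₁ ih₂ =>
    intro w h
    rcases h with h | h
    · obtain ⟨F, hF, h₁⟩ := ih₁ w h
      exact ⟨F, hF, fun Y f hf hr v hv => Or.inl (h₁ Y f hf hr v hv)⟩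
    · obtain ⟨F, hF, h₁⟩ := ih₂ w h
      exact ⟨F, hF, fun Y f hf hr v hv => Or.inr (h₁ Y f hf hr v hv)⟩
  | ex x _ ih =>
    intro w h
    obtain ⟨w', hw', h⟩ := Formula.realize_ex.1 h
    obtain ⟨F, hF, h₁⟩ := ih w' h
    -- The value of the quantified variable is the only new element the substructure must contain.
    refine ⟨insert ⟨x.1, w' x⟩ F, hF.insert _, fun Y f hf hr v hv => ?_⟩
    classical
    obtain ⟨y, hy⟩ := hr ⟨x.1, w' x⟩ (Set.mem_insert _ _)
    refine Formula.realize_ex.2 ⟨Function.update v x y,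
      fun z hz => Function.update_of_ne hz _ _,
      h₁ Y f hf (fun a ha => hr a (Set.mem_insert_of_mem _ ha)) _ fun z => ?_⟩
    by_cases hz : z = x
    · subst hz
      simpa using hy
    · rw [Function.update_of_ne hz, hv, hw' z hz]

/-! ### Atomic facts about named elements -/

/-- Atomic sentences in the constants of `L` and the names `K`. -/
inductive Fact (L : LocalLanguage.{u}) (K : L.Sorts → Type u) : Type u
  | const {s : L.Sorts} (c : L.Const s) (a : K s) : Fact L K
  | loc {s : L.Sorts} (d : L.Loc s) (a b : K s) : Fact L K
  | rel {l : List L.Sorts} (r : L.Rel l) (x : ∀ i : Fin l.length, K (l.get i)) : Fact L K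

/-- `F.Holds M q`: the fact `F` holds in `M` when the names are interpreted by `q`. -/
def Fact.Holds {K : L.Sorts → Type u} (M : L.Struc) (q : ∀ s, K s → M.carrier s) :
    Fact L K → Prop
  | .const c a => M.constMap c = q _ a
  | .loc d a b => M.locMap d (q _ a) (q _ b)
  | .rel r x => M.relMap r fun i => q _ (x i)

theorem Hom.holds {K : L.Sorts → Type u} {A B : L.Struc} (f : Hom A B)
    {q : ∀ s, K s → A.carrier s} {F : Fact L K} (h : F.Holds A q) :
    F.Holds B fun s a => f.toFun (q s a) := by
  cases F with
  | const c a => exact (f.map_const c).symm.trans (congrArg _ h)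
  | loc d a b => exact f.map_loc d _ _ h
  | rel r x => exact f.map_rel r _ h

/-- A structure generated by names maps to every structure satisfying the same facts. -/
theorem exists_hom_of_facts {K : L.Sorts → Type u} {A C : L.Struc} {q : ∀ s, K s → A.carrier s}
    (hq : ∀ s, Function.Surjective (q s)) {q' : ∀ s, K s → C.carrier s}
    (h : ∀ F : Fact L K, F.Holds A q → F.Holds C q') :
    ∃ f : Hom A C, ∀ s (a : K s), f.toFun (q s a) = q' s a := by
  choose σ hσ using hq
  refine ⟨⟨fun a => q' _ (σ _ a), fun c => ?_, fun r x hx => ?_, fun d a b hab => ?_⟩,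
    fun s a => ?_⟩
  · exact (h (.const c (σ _ (A.constMap c))) (hσ _ _).symm).symm
  · refine h (.rel r fun i => σ _ (x i)) ?_
    simpa only [Fact.Holds, hσ] using hx
  · refine h (.loc d (σ _ a) (σ _ b)) ?_
    simpa only [Fact.Holds, hσ] using hab
  -- Equality is among the facts, so `q'` does not depend on the name chosen by `σ`.
  · refine (C.locMap_one _ _).1 (h (.loc 1 (σ _ (q s a)) a) ?_)
    simp only [Fact.Holds, hσ, A.locMap_one]

/-- The names occurring in a fact. -/
def Fact.names {K : L.Sorts → Type u} : Fact L K → Set (Σ s, K s)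
  | .const _ a => {⟨_, a⟩}
  | .loc _ a b => {⟨_, a⟩, ⟨_, b⟩}
  | .rel _ x => Set.range fun i => ⟨_, x i⟩

theorem Fact.finite_names {K : L.Sorts → Type u} (F : Fact L K) : F.names.Finite := by
  cases F with
  | const c a => exact Set.finite_singleton _
  | loc d a b => exact (Set.finite_singleton _).insert _
  | rel r x => exact Set.finite_range _

/-- The formula obtained from a fact by replacing names by variables. -/
def Fact.toFormula {K : L.Sorts → Type u} (n : ∀ s, K s → ℕ) : Fact L K → L.Formula
  | .const c a => .loc 1 (.const c) (.var (n _ a))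
  | .loc d a b => .loc d (.var (n _ a)) (.var (n _ b))
  | .rel r x => .rel r fun i => .var (n _ (x i))

theorem Fact.isPositive_toFormula {K : L.Sorts → Type u} (n : ∀ s, K s → ℕ) (F : Fact L K) :
    (F.toFormula n).IsPositive := by
  cases F <;> constructor

theorem Fact.realize_toFormula {K : L.Sorts → Type u} {n : ∀ s, K s → ℕ} {F : Fact L K}
    {M : L.Struc} {w : M.Assignment} {q : ∀ s, K s → M.carrier s}
    (h : ∀ a ∈ F.names, w (a.1, n _ a.2) = q _ a.2) :
    (F.toFormula n).Realize M w ↔ F.Holds M q := by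
  cases F with
  | const c a =>
    have := h ⟨_, a⟩ rfl
    simp only [toFormula, Formula.Realize, Term.value, Holds, M.locMap_one] at this ⊢
    rw [this]
  | loc d a b =>
    have h₁ := h ⟨_, a⟩ (Or.inl rfl)
    have h₂ := h ⟨_, b⟩ (Or.inr rfl)
    simp only [toFormula, Formula.Realize, Term.value, Holds] at h₁ h₂ ⊢
    rw [h₁, h₂]
  | rel r x =>
    simp only [toFormula, Formula.Realize, Term.value, Holds]
    rw [show (fun i => w (_, n _ (x i))) = fun i => q _ (x i) from
      funext fun i => h ⟨_, x i⟩ ⟨i, rfl⟩]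

/-- Nonemptiness is needed because the syntax has no formula for truth to serve as the empty
conjunction. -/
theorem exists_conj {K : L.Sorts → Type u} (n : ∀ s, K s → ℕ) {Δ : Finset (Fact L K)}
    (hΔ : Δ.Nonempty) : ∃ ψ : L.Formula, ψ.IsPositive ∧ ∀ (M : L.Struc) (w : M.Assignment),
      ψ.Realize M w ↔ ∀ F ∈ Δ, (F.toFormula n).Realize M w := by
  induction hΔ using Finset.Nonempty.cons_induction with
  | singleton F => exact ⟨F.toFormula n, F.isPositive_toFormula n, fun M w => by simp⟩
  | cons F Δ hF hΔ ih =>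
    obtain ⟨ψ, hψ, h⟩ := ih
    refine ⟨.and (F.toFormula n) ψ, .and (F.isPositive_toFormula n) hψ, fun M w => ?_⟩
    rw [Finset.forall_mem_cons, ← h]
    rfl

theorem exists_iterated_ex (X : Finset L.Var) {φ : L.Formula} (hφ : φ.IsPositive) :
    ∃ ψ : L.Formula, ψ.IsPositive ∧ ∀ (M : L.Struc) (v : M.Assignment),
      ψ.Realize M v ↔ ∃ w : M.Assignment, (∀ y, y ∉ X → w y = v y) ∧ φ.Realize M w := by
  classical
  induction X using Finset.induction_on with
  | empty =>
    refine ⟨φ, hφ, fun M v => ⟨fun h => ⟨v, fun _ _ => rfl, h⟩, ?_⟩⟩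
    rintro ⟨w, hw, h⟩
    obtain rfl : w = v := funext fun y => hw y (Finset.notMem_empty y)
    exact h
  | insert x X hx ih =>
    obtain ⟨ψ, hψ, h⟩ := ih
    refine ⟨.ex x ψ, .ex x hψ, fun M v => ?_⟩
    rw [Formula.realize_ex]
    constructor
    · rintro ⟨w, hw, hr⟩
      obtain ⟨w', hw', hr⟩ := (h M w).1 hr
      refine ⟨w', fun y hy => ?_, hr⟩
      rw [Finset.mem_insert, not_or] at hy
      rw [hw' y hy.2, hw y hy.1]
    · rintro ⟨w, hw, hr⟩
      refine ⟨Function.update v x (w x), fun y hy => Function.update_of_ne hy _ _,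
        (h M _).2 ⟨w, fun y hy => ?_, hr⟩⟩
      by_cases hyx : y = x
      · subst hyx
        simp
      · rw [Function.update_of_ne hyx]
        exact hw y (by simp [hy, hyx])

/-- Finitely many facts about elements of `A` can be satisfied in `B` over common parameters, if
every positive formula which holds of the parameters in `A` holds of them in `B`. -/
theorem exists_interpretation {A B : L.Struc} {K : L.Sorts → Type u} (hK : ∀ s, Nonempty (K s))
    {f : ∀ s, K s → A.carrier s} {g : ∀ s, K s → B.carrier s}
    (H : ∀ φ : L.Formula, φ.IsPositive → ∀ v : ∀ y : L.Var, K y.1,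
      φ.Realize A (fun y => f _ (v y)) → φ.Realize B fun y => g _ (v y))
    (Δ : Finset (Fact L fun s => A.carrier s ⊕ K s))
    (hΔ : ∀ F ∈ Δ, F.Holds A fun s => Sum.elim id (f s)) :
    ∃ τ : ∀ s, A.carrier s → B.carrier s, ∀ F ∈ Δ, F.Holds B fun s => Sum.elim (τ s) (g s) := by
  classical
  rcases Δ.eq_empty_or_nonempty with rfl | hne
  · exact ⟨fun s _ => (B.nonempty_carrier s).some, by simp⟩
  set Nm : Set (Σ s, A.carrier s ⊕ K s) := ⋃ F ∈ Δ, F.names with hNm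
  have hfin : Nm.Finite := Δ.finite_toSet.biUnion fun F _ => F.finite_names
  -- Numbering the finitely many names injectively gives distinct names distinct variables.
  obtain ⟨ν, hν⟩ := Set.countable_iff_exists_injOn.1 hfin.countable
  have hν' : ∀ s (a b : A.carrier s ⊕ K s), (⟨s, a⟩ : Σ s, A.carrier s ⊕ K s) ∈ Nm →
      (⟨s, b⟩ : Σ s, A.carrier s ⊕ K s) ∈ Nm → ν ⟨s, a⟩ = ν ⟨s, b⟩ → a = b :=
    fun s a b ha hb h => by simpa using hν ha hb h
  let n : ∀ s, A.carrier s ⊕ K s → ℕ := fun s a => ν ⟨s, a⟩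
  obtain ⟨ψ, hψ, hψr⟩ := exists_conj n hne
  -- Only the variables of elements of `A` are quantified. Those of parameters stay free, so that
  -- `H` applies.
  have hX : {y : L.Var | ∃ a : A.carrier y.1,
      (⟨y.1, .inl a⟩ : Σ s, A.carrier s ⊕ K s) ∈ Nm ∧ n y.1 (.inl a) = y.2}.Finite := by
    refine (hfin.image fun p : (Σ s, A.carrier s ⊕ K s) => ((p.1, ν p) : L.Var)).subset ?_
    rintro ⟨s, m⟩ ⟨a, ha, hm⟩
    exact ⟨_, ha, Prod.ext rfl hm⟩
  obtain ⟨χ, hχ, hχr⟩ := exists_iterated_ex hX.toFinset hψ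
  -- A variable standing for a parameter receives that parameter; any other receives an arbitrary
  -- one of its sort.
  have hv : ∀ y : L.Var, ∃ k : K y.1, ∀ k' : K y.1,
      (⟨y.1, .inr k'⟩ : Σ s, A.carrier s ⊕ K s) ∈ Nm → n y.1 (.inr k') = y.2 → k' = k := by
    intro y
    by_cases h : ∃ k : K y.1, (⟨y.1, .inr k⟩ : Σ s, A.carrier s ⊕ K s) ∈ Nm ∧
        n y.1 (.inr k) = y.2
    · obtain ⟨k, hk, hy⟩ := h
      exact ⟨k, fun k' hk' hy' => Sum.inr.inj (hν' _ _ _ hk' hk (hy'.trans hy.symm))⟩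
    · exact ⟨(hK y.1).some, fun k' hk' hy' => (h ⟨k', hk', hy'⟩).elim⟩
  choose v hv using hv
  have hw : ∀ y : L.Var, ∃ a : A.carrier y.1, (y ∉ hX.toFinset → a = f _ (v y)) ∧
      ∀ p : A.carrier y.1 ⊕ K y.1, (⟨y.1, p⟩ : Σ s, A.carrier s ⊕ K s) ∈ Nm → n y.1 p = y.2 →
        a = Sum.elim id (f _) p := by
    intro y
    by_cases h : y ∈ hX.toFinset
    · obtain ⟨a, ha, hy⟩ := (hX.mem_toFinset).1 h
      refine ⟨a, fun h' => (h' h).elim, fun p hp hpy => ?_⟩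
      rw [hν' _ _ _ hp ha (hpy.trans hy.symm)]
      rfl
    · refine ⟨f _ (v y), fun _ => rfl, ?_⟩
      rintro (a | k) hp hpy
      · exact (h (hX.mem_toFinset.2 ⟨a, hp, hpy⟩)).elim
      · rw [hv y k hp hpy]
        rfl
  choose w hw₁ hw₂ using hw
  have hA : χ.Realize A fun y => f _ (v y) := by
    refine (hχr _ _).2 ⟨w, hw₁, (hψr _ _).2 fun F hF => ?_⟩
    refine (Fact.realize_toFormula fun a ha => ?_).2 (hΔ F hF)
    exact hw₂ _ _ (Set.mem_biUnion hF ha) rfl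
  obtain ⟨w', hw', hr⟩ := (hχr _ _).1 (H χ hχ v hA)
  refine ⟨fun s a => w' (s, n s (.inl a)), fun F hF => ?_⟩
  refine (Fact.realize_toFormula ?_).1 ((hψr _ _).1 hr F hF)
  rintro ⟨s, a | k⟩ ha
  · rfl
  · have hmem : (⟨s, .inr k⟩ : Σ s, A.carrier s ⊕ K s) ∈ Nm := Set.mem_biUnion hF ha
    refine (hw' (s, n s (.inr k)) fun h => ?_).trans ?_
    · obtain ⟨a, ha, hy⟩ := hX.mem_toFinset.1 h
      simpa using hν' _ _ _ ha hmem hy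
    · rw [← hv (s, n s (.inr k)) k hmem rfl]
      rfl

/-! ### Ultrapowers -/

open Filter

/-- The ultrapower of a structure. -/
def Struc.ultrapower (B : L.Struc) {I : Type u} (U : Ultrafilter I) : L.Struc where
  carrier s := (U : Filter I).Germ (B.carrier s)
  nonempty_carrier s := (B.nonempty_carrier s).map fun b => Germ.const b
  constMap c := Germ.const (B.constMap c)
  relMap {l} r x := ∃ y : ∀ k : Fin l.length, I → B.carrier (l.get k),
    (∀ k, x k = Germ.ofFun (y k)) ∧ ∀ᶠ i in U, B.relMap r fun k => y k i
  locMap d a b := Germ.LiftRel (B.locMap d) a b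
  locMap_one a b := by
    induction a, b using Germ.inductionOn₂ with
    | _ f g =>
    rw [Germ.liftRel_coe, Germ.coe_eq]
    exact eventually_congr (Eventually.of_forall fun i => B.locMap_one _ _)

theorem Term.value_ultrapower {B : L.Struc} {I : Type u} {U : Ultrafilter I}
    (v : ∀ y : L.Var, I → B.carrier y.1) {s : L.Sorts} (t : L.Term s) :
    t.value (B.ultrapower U) (fun y => Germ.ofFun (v y)) =
      Germ.ofFun fun i => t.value B fun y => v y i := by
  cases t <;> rfl

/-- One half of Łoś's theorem, by induction on `φ`. It suffices for transferring negative sentences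
to the ultrapower. -/
theorem Formula.IsPositive.eventually_of_ultrapower {B : L.Struc} {I : Type u} {U : Ultrafilter I}
    {φ : L.Formula} (hφ : φ.IsPositive) : ∀ v : ∀ y : L.Var, I → B.carrier y.1,
      φ.Realize (B.ultrapower U) (fun y => Germ.ofFun (v y)) →
        ∀ᶠ i in U, φ.Realize B fun y => v y i := by
  induction hφ with
  | loc d t₁ t₂ =>
    intro v h
    simp only [Formula.Realize, Term.value_ultrapower] at h
    exact h
  | rel r t =>
    intro v h
    simp only [Formula.Realize, Term.value_ultrapower] at h
    obtain ⟨y, hy, h⟩ := h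
    have hy : ∀ k, (fun i => (t k).value B fun y => v y i) =ᶠ[U] y k :=
      fun k => Germ.coe_eq.1 (hy k)
    -- The arity is finite, so the chosen representatives agree with the given ones simultaneously
    -- at almost all indices.
    filter_upwards [h, eventually_all.2 hy] with i h₁ h₂
    simp only [Formula.Realize, h₂]
    exact h₁
  | and _ _ ih₁ ih₂ => exact fun v h => (ih₁ v h.1).and (ih₂ v h.2)
  | or _ _ ih₁ ih₂ =>
    exact fun v h => h.elim (fun h => (ih₁ v h).mono fun _ => Or.inl)
      fun h => (ih₂ v h).mono fun _ => Or.inr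
  | ex x _ ih =>
    intro v h
    classical
    obtain ⟨w, hw, h⟩ := Formula.realize_ex.1 h
    obtain ⟨b, hb⟩ : ∃ b : I → B.carrier x.1, w x = Germ.ofFun b :=
      Germ.inductionOn (w x) (p := fun a => ∃ b, a = Germ.ofFun b) fun b => ⟨b, rfl⟩
    have : w = fun y => Germ.ofFun (Function.update v x b y) := by
      funext y
      by_cases hy : y = x
      · subst hy
        simpa using hb
      · rw [hw y hy, Function.update_of_ne hy]
    rw [this] at h
    filter_upwards [ih _ h] with i hi
    exact Formula.realize_ex.2 ⟨_, fun y hy => by rw [Function.update_of_ne hy], hi⟩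

theorem Fact.holds_ultrapower {B : L.Struc} {I : Type u} {U : Ultrafilter I}
    {K : L.Sorts → Type u} {q : ∀ s, K s → I → B.carrier s} {F : Fact L K}
    (h : ∀ᶠ i in U, F.Holds B fun s a => q s a i) :
    F.Holds (B.ultrapower U) fun s a => Germ.ofFun (q s a) := by
  cases F with
  | const c a => exact Germ.coe_eq.2 h
  | loc d a b => exact h
  | rel r x => exact ⟨fun k => q _ (x k), fun _ => rfl, h⟩

/-- The elements of the ultrapower at bounded distance from an element of `B`. -/
def Struc.nearSet (B : L.Struc) {I : Type u} (U : Ultrafilter I) (s : L.Sorts) :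
    Set ((B.ultrapower U).carrier s) :=
  {a | ∃ (d : L.Loc s) (b : B.carrier s), (B.ultrapower U).locMap d a (Germ.const b)}

theorem Struc.const_mem_nearSet (B : L.Struc) {I : Type u} (U : Ultrafilter I) {s : L.Sorts}
    (b : B.carrier s) : (Germ.const b : (U : Filter I).Germ (B.carrier s)) ∈ B.nearSet U s :=
  ⟨1, b, ((B.ultrapower U).locMap_one _ _).2 rfl⟩

/-- The substructure of the ultrapower of `B` on the elements at bounded distance from `B`. -/
def Struc.localUltrapower (B : L.Struc) {I : Type u} (U : Ultrafilter I) : L.Struc :=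
  (B.ultrapower U).induced (B.nearSet U)
    (fun s => (B.nonempty_carrier s).elim fun b => ⟨_, B.const_mem_nearSet U b⟩)
    fun c => B.const_mem_nearSet U (B.constMap c)

/-- The inclusion of the local ultrapower in the ultrapower. -/
def Struc.localUltrapowerIncl (B : L.Struc) {I : Type u} (U : Ultrafilter I) :
    Hom (B.localUltrapower U) (B.ultrapower U) :=
  (B.ultrapower U).inducedIncl _ _ fun c => B.const_mem_nearSet U (B.constMap c)

/-- Only the last axiom needs the restriction to near elements: in the full ultrapower the distance
symbol could vary with the index. Two near elements are joined through their neighbours in `B`. -/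
theorem Struc.IsLocal.localUltrapower {B : L.Struc} (hB : B.IsLocal) {I : Type u}
    (U : Ultrafilter I) : (B.localUltrapower U).IsLocal := by
  have symm : ∀ {s : L.Sorts} (d : L.Loc s) (a b : (B.ultrapower U).carrier s),
      (B.ultrapower U).locMap d a b → (B.ultrapower U).locMap d b a := by
    intro s d a b
    induction a, b using Germ.inductionOn₂ with
    | _ f g => exact fun h => h.mono fun i hi => hB.symm _ _ _ hi
  have comp : ∀ {s : L.Sorts} (d₁ d₂ : L.Loc s) (a b c : (B.ultrapower U).carrier s),
      (B.ultrapower U).locMap d₁ a b → (B.ultrapower U).locMap d₂ b c →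
        (B.ultrapower U).locMap (d₁ * d₂) a c := by
    intro s d₁ d₂ a b c
    induction a, b, c using Germ.inductionOn₃ with
    | _ f g k =>
    intro h₁ h₂
    filter_upwards [h₁, h₂] with i hi₁ hi₂
    exact hB.comp _ _ _ _ _ hi₁ hi₂
  refine ⟨fun d a b h => symm d _ _ h, ?_, fun d₁ d₂ a b c h₁ h₂ => comp d₁ d₂ _ _ _ h₁ h₂, ?_, ?_⟩
  · rintro s d₁ d₂ hd ⟨a, ha⟩ ⟨b, hb⟩ h
    induction a, b using Germ.inductionOn₂ with
    | _ f g => exact Eventually.mono h fun i hi => hB.mono _ _ hd _ _ hi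
  · exact fun c₁ c₂ => Eventually.of_forall fun i => hB.bound c₁ c₂
  · rintro s ⟨a, d₁, b₁, h₁⟩ ⟨a', d₂, b₂, h₂⟩
    obtain ⟨d, hd⟩ := hB.exists_loc b₁ b₂
    have hd' : (B.ultrapower U).locMap d (Germ.const b₁) (Germ.const b₂) :=
      Eventually.of_forall fun _ => hd
    exact ⟨d₁ * d * d₂, comp _ _ _ _ _ (comp _ _ _ _ _ h₁ hd') (symm _ _ _ h₂)⟩

/-- A positive sentence true in the local part goes up to the full ultrapower, and from there down
to some coordinate, which is `B`. -/
theorem Struc.IsLocalModel.localUltrapower {T : Set L.Formula} (hT : IsNegativeLocalTheory T)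
    {B : L.Struc} (hB : B.IsLocalModel T) {I : Type u} (U : Ultrafilter I) :
    (B.localUltrapower U).IsLocalModel T := by
  refine ⟨hB.1.localUltrapower U, fun φ hφ v => ?_⟩
  obtain ⟨ψ, hψ, rfl⟩ := hT.isNegative φ hφ
  intro h
  have h₁ := (B.localUltrapowerIncl U).realize hψ v h
  have : ∀ y : L.Var, ∃ b : I → B.carrier y.1, (v y).1 = Germ.ofFun b := fun y =>
    Germ.inductionOn (v y).1 (p := fun a => ∃ b, a = Germ.ofFun b) fun b => ⟨b, rfl⟩
  choose b hb using this
  have h₂ : ψ.Realize (B.ultrapower U) fun y => Germ.ofFun (b y) := by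
    have hv : (fun y => Germ.ofFun (b y)) = fun y => (v y).1 := funext fun y => (hb y).symm
    exact hv ▸ h₁
  obtain ⟨i, hi⟩ := (hψ.eventually_of_ultrapower b h₂).exists
  exact hB.2 _ hφ _ hi

/-! ### Amalgamation -/

/-- Amalgamation over parameters whose positive type in `A` is contained in that in `B`. -/
theorem exists_amalgam {T : Set L.Formula} (hT : IsNegativeLocalTheory T) {A B : L.Struc}
    (hA : A.IsLocal) (hB : B.IsLocalModel T) {K : L.Sorts → Type u} (hK : ∀ s, Nonempty (K s))
    {f : ∀ s, K s → A.carrier s} {g : ∀ s, K s → B.carrier s}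
    (H : ∀ φ : L.Formula, φ.IsPositive → ∀ v : ∀ y : L.Var, K y.1,
      φ.Realize A (fun y => f _ (v y)) → φ.Realize B fun y => g _ (v y)) :
    ∃ C : L.Struc, C.IsLocalModel T ∧ ∃ (h : Hom A C) (k : Hom B C),
      ∀ s (a : K s), h.toFun (f s a) = k.toFun (g s a) := by
  classical
  let I := Finset {F : Fact L fun s => A.carrier s ⊕ K s // F.Holds A fun s => Sum.elim id (f s)}
  -- Almost every index contains any given fact of `A`, so `τ` satisfies that fact almost
  -- everywhere.
  let U : Ultrafilter I := Ultrafilter.of atTop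
  have hτ : ∀ Δ : I, ∃ τ : ∀ s, A.carrier s → B.carrier s,
      ∀ F ∈ Δ, F.1.Holds B fun s => Sum.elim (τ s) (g s) := by
    intro Δ
    obtain ⟨τ, hτ⟩ := exists_interpretation hK H (Δ.image Subtype.val) (by
      intro F hF
      obtain ⟨F, -, rfl⟩ := Finset.mem_image.1 hF
      exact F.2)
    exact ⟨τ, fun F hF => hτ _ (Finset.mem_image_of_mem _ hF)⟩
  choose τ hτ using hτ
  let q : ∀ s, A.carrier s ⊕ K s → I → B.carrier s := fun s a Δ => Sum.elim (τ Δ s) (g s) a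
  have key : ∀ F : Fact L fun s => A.carrier s ⊕ K s, (F.Holds A fun s => Sum.elim id (f s)) →
      F.Holds (B.ultrapower U) fun s a => Germ.ofFun (q s a) := by
    intro F hF
    refine Fact.holds_ultrapower (Ultrafilter.of_le atTop ?_)
    filter_upwards [eventually_ge_atTop ({⟨F, hF⟩} : I)] with Δ hΔ
    have := hτ Δ ⟨F, hF⟩ (hΔ (Finset.mem_singleton_self _))
    convert this using 2 with s a
  have hr : ∀ s (a : K s), (Germ.ofFun (q s (.inr a)) : (U : Filter I).Germ (B.carrier s)) =
      Germ.const (g s a) := fun s a => rfl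
  have hmem : ∀ s (a : A.carrier s),
      (Germ.ofFun (q s (.inl a)) : (U : Filter I).Germ (B.carrier s)) ∈ B.nearSet U s := by
    intro s a
    obtain ⟨k⟩ := hK s
    -- The distance of `a` to a parameter is itself a fact, hence preserved; the parameter goes to a
    -- constant germ, that is, into `B`.
    obtain ⟨d, hd⟩ := hA.exists_loc a (f s k)
    exact ⟨d, g s k, key (.loc d (.inl a) (.inr k)) hd⟩
  refine ⟨B.localUltrapower U, hB.localUltrapower hT U,
    ⟨fun a => ⟨_, hmem _ a⟩, fun c => Subtype.ext ?_, fun {l} r x hx => ?_, fun d a b hd => ?_⟩,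
    ⟨fun b => ⟨_, B.const_mem_nearSet U b⟩, fun c => rfl, fun {l} r x hx => ?_, fun d a b hd => ?_⟩,
    fun s a => Subtype.ext ?_⟩
  · exact (key (.const c (.inl (A.constMap c))) rfl).symm
  · exact key (.rel r fun i => .inl (x i)) hx
  · exact key (.loc d (.inl a) (.inl b)) hd
  · exact ⟨fun k _ => x k, fun _ => rfl, Eventually.of_forall fun _ => hx⟩
  · exact Eventually.of_forall fun _ => hd
  · exact ((B.ultrapower U).locMap_one _ _).1
      (key (.loc 1 (.inl (f s a)) (.inr a)) ((A.locMap_one _ _).2 rfl))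

/-! ### Local models with named elements -/

/-- A local model of `T` all of whose elements have names in `W`. -/
structure Named (L : LocalLanguage.{u}) (T : Set L.Formula) (W : Type u) where
  /-- The underlying structure. -/
  str : L.Struc
  isLocalModel : str.IsLocalModel T
  /-- The names which are used on each sort. -/
  dom : L.Sorts → Set W
  /-- The element with a given name. -/
  val : ∀ s, W → str.carrier s
  exists_name : ∀ s (a : str.carrier s), ∃ w ∈ dom s, val s w = a

namespace Named

variable {T : Set L.Formula} {W : Type u}

/-- Every element is named, so a homomorphism preserving names is unique. Mere existence therefore
suffices, and the maps commute automatically. -/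
instance : Preorder (Named L T W) where
  le x y := (∀ s, x.dom s ⊆ y.dom s) ∧
    ∃ h : Hom x.str y.str, ∀ s, ∀ w ∈ x.dom s, h.toFun (x.val s w) = y.val s w
  le_refl x := ⟨fun _ => subset_rfl, Hom.id _, fun _ _ _ => rfl⟩
  le_trans x y z := by
    rintro ⟨d, h, hh⟩ ⟨d', h', hh'⟩
    refine ⟨fun s => (d s).trans (d' s), h'.comp h, fun s w hw => ?_⟩
    simp only [Hom.comp]
    rw [hh s w hw, hh' s w (d s hw)]

variable {x y : Named L T W}

theorem dom_mono (h : x ≤ y) {s : L.Sorts} {w : W} (hw : w ∈ x.dom s) : w ∈ y.dom s :=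
  h.1 s hw

theorem val_eq_of_le (h : x ≤ y) {s : L.Sorts} {w w' : W} (hw : w ∈ x.dom s) (hw' : w' ∈ x.dom s)
    (he : x.val s w = x.val s w') : y.val s w = y.val s w' := by
  obtain ⟨-, f, hf⟩ := h
  rw [← hf s w hw, ← hf s w' hw', he]

theorem const_eq_of_le (h : x ≤ y) {s : L.Sorts} {c : L.Const s} {w : W} (hw : w ∈ x.dom s)
    (he : x.str.constMap c = x.val s w) : y.str.constMap c = y.val s w := by
  obtain ⟨-, f, hf⟩ := h
  rw [← hf s w hw, ← he, f.map_const]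

theorem loc_of_le (h : x ≤ y) {s : L.Sorts} {d : L.Loc s} {w w' : W} (hw : w ∈ x.dom s)
    (hw' : w' ∈ x.dom s) (hd : x.str.locMap d (x.val s w) (x.val s w')) :
    y.str.locMap d (y.val s w) (y.val s w') := by
  obtain ⟨-, f, hf⟩ := h
  rw [← hf s w hw, ← hf s w' hw']
  exact f.map_loc d _ _ hd

theorem rel_of_le (h : x ≤ y) {l : List L.Sorts} {r : L.Rel l} {w : Fin l.length → W}
    (hw : ∀ i, w i ∈ x.dom (l.get i)) (hr : x.str.relMap r fun i => x.val _ (w i)) :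
    y.str.relMap r fun i => y.val _ (w i) := by
  obtain ⟨-, f, hf⟩ := h
  rw [show (fun i => y.val (l.get i) (w i)) = fun i => f.toFun (x.val _ (w i)) from
    funext fun i => (hf _ _ (hw i)).symm]
  exact f.map_rel r _ hr

theorem realize_of_le (h : x ≤ y) {φ : L.Formula} (hφ : φ.IsPositive) {v : L.Var → W}
    (hv : ∀ z, v z ∈ x.dom z.1) (hr : φ.Realize x.str fun z => x.val _ (v z)) :
    φ.Realize y.str fun z => y.val _ (v z) := by
  obtain ⟨-, f, hf⟩ := h
  rw [show (fun z : L.Var => y.val z.1 (v z)) = fun z => f.toFun (x.val _ (v z)) from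
    funext fun z => (hf _ _ (hv z)).symm]
  exact f.realize hφ _ hr

theorem exists_hom_of_le (h : x ≤ y) :
    ∃ f : Hom x.str y.str, ∀ s, ∀ w ∈ x.dom s, f.toFun (x.val s w) = y.val s w :=
  h.2

/-! ### Direct limits -/

section Limit

variable {ι : Type*} [Nonempty ι] (X : ι → Named L T W)

/-- Identification of names at some stage. -/
def limSetoid (hX : Directed (· ≤ ·) X) (s : L.Sorts) : Setoid {w : W // ∃ i, w ∈ (X i).dom s} where
  r w w' := ∃ i, w.1 ∈ (X i).dom s ∧ w'.1 ∈ (X i).dom s ∧ (X i).val s w = (X i).val s w'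
  iseqv := by
    refine ⟨fun w => w.2.imp fun i hi => ⟨hi, hi, rfl⟩, ?_, ?_⟩
    · rintro w w' ⟨i, h, h', he⟩
      exact ⟨i, h', h, he.symm⟩
    · rintro w₁ w₂ w₃ ⟨i, h₁, h₂, he⟩ ⟨j, h₂', h₃, he'⟩
      obtain ⟨k, hik, hjk⟩ := hX i j
      exact ⟨k, dom_mono hik h₁, dom_mono hjk h₃,
        (val_eq_of_le hik h₁ h₂ he).trans (val_eq_of_le hjk h₂' h₃ he')⟩

variable {X}
variable (hX : Directed (· ≤ ·) X)

/-- The universe of the direct limit. -/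
def LimCarrier (s : L.Sorts) : Type u := Quotient (limSetoid X hX s)

theorem nonempty_limCarrier (s : L.Sorts) : Nonempty (LimCarrier hX s) := by
  obtain ⟨i⟩ := ‹Nonempty ι›
  obtain ⟨a⟩ := (X i).str.nonempty_carrier s
  obtain ⟨w, hw, -⟩ := (X i).exists_name s a
  exact ⟨Quotient.mk _ ⟨w, i, hw⟩⟩

/-- The class of a name in the direct limit. -/
def limMk (s : L.Sorts) (w : {w : W // ∃ i, w ∈ (X i).dom s}) : LimCarrier hX s :=
  Quotient.mk _ w

open Classical in
/-- The element of the direct limit with a given name. -/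
noncomputable def limVal (s : L.Sorts) (w : W) : LimCarrier hX s :=
  if h : ∃ i, w ∈ (X i).dom s then limMk hX s ⟨w, h⟩ else (nonempty_limCarrier hX s).some

theorem limVal_eq_iff {s : L.Sorts} {w w' : W} {i j : ι} (hw : w ∈ (X i).dom s)
    (hw' : w' ∈ (X j).dom s) : limVal hX s w = limVal hX s w' ↔
      ∃ k, w ∈ (X k).dom s ∧ w' ∈ (X k).dom s ∧ (X k).val s w = (X k).val s w' := by
  rw [limVal, limVal, dif_pos ⟨i, hw⟩, dif_pos ⟨j, hw'⟩]
  exact Quotient.eq (r := limSetoid X hX s)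

theorem exists_limVal_eq {s : L.Sorts} (a : LimCarrier hX s) :
    ∃ i, ∃ w ∈ (X i).dom s, limVal hX s w = a := by
  induction a using Quotient.inductionOn with
  | _ w =>
  obtain ⟨w, i, hw⟩ := w
  exact ⟨i, w, hw, dif_pos ⟨i, hw⟩⟩

/-- Names which agree in the limit agree at some later stage. -/
theorem exists_val_eq {s : L.Sorts} {w w' : W} {i j : ι} (hw : w ∈ (X i).dom s)
    (hw' : w' ∈ (X j).dom s) (h : limVal hX s w = limVal hX s w') :
    ∃ k, X i ≤ X k ∧ X j ≤ X k ∧ (X k).val s w = (X k).val s w' := by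
  obtain ⟨m, hm, hm', he⟩ := (limVal_eq_iff hX hw hw').1 h
  obtain ⟨k, hik, hjk⟩ := hX i j
  obtain ⟨n, hkn, hmn⟩ := hX k m
  exact ⟨n, hik.trans hkn, hjk.trans hkn, val_eq_of_le hmn hm hm' he⟩

/-- The direct limit of a directed family. -/
noncomputable def limStruc : L.Struc where
  carrier := LimCarrier hX
  nonempty_carrier := nonempty_limCarrier hX
  constMap {s} c := limVal hX s
    ((X (Classical.arbitrary ι)).exists_name s ((X (Classical.arbitrary ι)).str.constMap c)).choose
  relMap {l} r z := ∃ (i : ι) (w : Fin l.length → W), (∀ k, w k ∈ (X i).dom (l.get k)) ∧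
    (∀ k, limVal hX _ (w k) = z k) ∧ (X i).str.relMap r fun k => (X i).val _ (w k)
  locMap {s} d a b := ∃ (i : ι) (w w' : W), w ∈ (X i).dom s ∧ w' ∈ (X i).dom s ∧
    limVal hX s w = a ∧ limVal hX s w' = b ∧ (X i).str.locMap d ((X i).val s w) ((X i).val s w')
  locMap_one {s} a b := by
    constructor
    · rintro ⟨i, w, w', hw, hw', rfl, rfl, h⟩
      exact (limVal_eq_iff hX hw hw').2 ⟨i, hw, hw', ((X i).str.locMap_one _ _).1 h⟩
    · rintro rfl
      obtain ⟨i, w, hw, rfl⟩ := exists_limVal_eq hX a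
      exact ⟨i, w, w, hw, hw, rfl, rfl, ((X i).str.locMap_one _ _).2 rfl⟩

theorem limStruc_const {s : L.Sorts} (c : L.Const s) {i : ι} {w : W} (hw : w ∈ (X i).dom s)
    (h : (X i).str.constMap c = (X i).val s w) :
    (limStruc hX).constMap c = limVal hX s w := by
  have h₀ := ((X (Classical.arbitrary ι)).exists_name s
    ((X (Classical.arbitrary ι)).str.constMap c)).choose_spec
  obtain ⟨k, hk, hik⟩ := hX (Classical.arbitrary ι) i
  exact (limVal_eq_iff hX h₀.1 hw).2 ⟨k, dom_mono hk h₀.1, dom_mono hik hw,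
    (const_eq_of_le hk h₀.1 h₀.2.symm).symm.trans (const_eq_of_le hik hw h)⟩

/-- The relation in the limit comes with its own names for the two elements; it holds of the given
names from a stage on where both pairs of names agree. -/
theorem limStruc_loc {s : L.Sorts} {d : L.Loc s} {i : ι} {w w' : W} (hw : w ∈ (X i).dom s)
    (hw' : w' ∈ (X i).dom s) (h : (limStruc hX).locMap d (limVal hX s w) (limVal hX s w')) :
    ∃ k, X i ≤ X k ∧ (X k).str.locMap d ((X k).val s w) ((X k).val s w') := by
  obtain ⟨j, u, u', hu, hu', e, e', h⟩ := h
  obtain ⟨k₁, hj₁, hi₁, e₁⟩ := exists_val_eq hX hu hw e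
  obtain ⟨k₂, hj₂, hi₂, e₂⟩ := exists_val_eq hX hu' hw' e'
  obtain ⟨k, hk₁, hk₂⟩ := hX k₁ k₂
  refine ⟨k, hi₁.trans hk₁, ?_⟩
  rw [← val_eq_of_le hk₁ (dom_mono hj₁ hu) (dom_mono hi₁ hw) e₁,
    ← val_eq_of_le hk₂ (dom_mono hj₂ hu') (dom_mono hi₂ hw') e₂]
  exact loc_of_le (hj₁.trans hk₁) hu hu' h

theorem limStruc_rel {l : List L.Sorts} {r : L.Rel l} {i : ι} {w : Fin l.length → W}
    (hw : ∀ k, w k ∈ (X i).dom (l.get k))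
    (h : (limStruc hX).relMap r fun k => limVal hX _ (w k)) :
    ∃ k, X i ≤ X k ∧ (X k).str.relMap r fun n => (X k).val _ (w n) := by
  obtain ⟨j, u, hu, e, h⟩ := h
  choose m hjm him he using fun n => exists_val_eq hX (hu n) (hw n) (e n)
  obtain ⟨k₀, hk₀⟩ := hX.finite_le m
  obtain ⟨k₁, hi₁, hj₁⟩ := hX i j
  obtain ⟨k, h₀, h₁⟩ := hX k₀ k₁
  refine ⟨k, hi₁.trans h₁, ?_⟩
  rw [show (fun n => (X k).val (l.get n) (w n)) = fun n => (X k).val _ (u n) from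
    funext fun n => (val_eq_of_le ((hk₀ n).trans h₀) (dom_mono (hjm n) (hu n))
      (dom_mono (him n) (hw n)) (he n)).symm]
  exact rel_of_le (hj₁.trans h₁) hu h

theorem exists_limVal_eq_above {s : L.Sorts} (i : ι) (a : LimCarrier hX s) :
    ∃ j, X i ≤ X j ∧ ∃ w ∈ (X j).dom s, limVal hX s w = a := by
  obtain ⟨j, w, hw, e⟩ := exists_limVal_eq hX a
  obtain ⟨k, hi, hj⟩ := hX i j
  exact ⟨k, hi, w, dom_mono hj hw, e⟩

theorem isLocal_limStruc : (limStruc hX).IsLocal where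
  symm := by
    rintro s d a b ⟨i, w, w', hw, hw', e, e', h⟩
    exact ⟨i, w', w, hw', hw, e', e, (X i).isLocalModel.1.symm _ _ _ h⟩
  mono := by
    rintro s d₁ d₂ hd a b ⟨i, w, w', hw, hw', e, e', h⟩
    exact ⟨i, w, w', hw, hw', e, e', (X i).isLocalModel.1.mono _ _ hd _ _ h⟩
  comp := by
    rintro s d₁ d₂ a b c h₁ h₂
    obtain ⟨i, w₁, hw₁, rfl⟩ := exists_limVal_eq hX a
    obtain ⟨j, hij, w₂, hw₂, rfl⟩ := exists_limVal_eq_above hX i b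
    obtain ⟨k, hjk, w₃, hw₃, rfl⟩ := exists_limVal_eq_above hX j c
    replace hw₂ := dom_mono hjk hw₂
    replace hw₁ := dom_mono (hij.trans hjk) hw₁
    obtain ⟨m, hkm, h₁⟩ := limStruc_loc hX hw₁ hw₂ h₁
    obtain ⟨n, hkn, h₂⟩ := limStruc_loc hX hw₂ hw₃ h₂
    obtain ⟨p, hmp, hnp⟩ := hX m n
    have hkp := hkm.trans hmp
    exact ⟨p, w₁, w₃, dom_mono hkp hw₁, dom_mono hkp hw₃, rfl, rfl,
      (X p).isLocalModel.1.comp _ _ _ _ _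
        (loc_of_le hmp (dom_mono hkm hw₁) (dom_mono hkm hw₂) h₁)
        (loc_of_le hnp (dom_mono hkn hw₂) (dom_mono hkn hw₃) h₂)⟩
  bound := by
    intro s c₁ c₂
    obtain ⟨i⟩ := ‹Nonempty ι›
    obtain ⟨w₁, hw₁, e₁⟩ := (X i).exists_name s ((X i).str.constMap c₁)
    obtain ⟨w₂, hw₂, e₂⟩ := (X i).exists_name s ((X i).str.constMap c₂)
    refine ⟨i, w₁, w₂, hw₁, hw₂, (limStruc_const hX c₁ hw₁ e₁.symm).symm,
      (limStruc_const hX c₂ hw₂ e₂.symm).symm, ?_⟩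
    rw [e₁, e₂]
    exact (X i).isLocalModel.1.bound c₁ c₂
  exists_loc := by
    intro s a b
    obtain ⟨i, w₁, hw₁, rfl⟩ := exists_limVal_eq hX a
    obtain ⟨j, hij, w₂, hw₂, rfl⟩ := exists_limVal_eq_above hX i b
    obtain ⟨d, hd⟩ := (X j).isLocalModel.1.exists_loc ((X j).val s w₁) ((X j).val s w₂)
    exact ⟨d, j, w₁, w₂, dom_mono hij hw₁, hw₂, rfl, rfl, hd⟩

/-- Terms have names, uniformly in the stage. -/
theorem exists_name_value {i : ι} {v : L.Var → W} (hv : ∀ z, v z ∈ (X i).dom z.1) {s : L.Sorts}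
    (t : L.Term s) : ∃ w ∈ (X i).dom s,
      t.value (limStruc hX) (fun z => limVal hX _ (v z)) = limVal hX s w ∧
      ∀ k, X i ≤ X k → t.value (X k).str (fun z => (X k).val _ (v z)) = (X k).val s w := by
  cases t with
  | var n => exact ⟨v (s, n), hv (s, n), rfl, fun _ _ => rfl⟩
  | const c =>
    obtain ⟨w, hw, e⟩ := (X i).exists_name s ((X i).str.constMap c)
    exact ⟨w, hw, limStruc_const hX c hw e.symm, fun k hk => const_eq_of_le hk hw e.symm⟩

/-- A positive formula needs only finitely many witnesses and identifications of names, and these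
are all present at some stage. -/
theorem exists_realize_of_limStruc {φ : L.Formula} (hφ : φ.IsPositive) :
    ∀ (i : ι) (v : L.Var → W), (∀ z, v z ∈ (X i).dom z.1) →
      φ.Realize (limStruc hX) (fun z => limVal hX _ (v z)) →
        ∃ k, X i ≤ X k ∧ φ.Realize (X k).str fun z => (X k).val _ (v z) := by
  induction hφ with
  | loc d t₁ t₂ =>
    intro i v hv h
    obtain ⟨w₁, hw₁, e₁, e₁'⟩ := exists_name_value hX hv t₁
    obtain ⟨w₂, hw₂, e₂, e₂'⟩ := exists_name_value hX hv t₂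
    simp only [Formula.Realize, e₁, e₂] at h
    obtain ⟨k, hk, h⟩ := limStruc_loc hX hw₁ hw₂ h
    refine ⟨k, hk, ?_⟩
    simpa only [Formula.Realize, e₁' k hk, e₂' k hk] using h
  | rel r t =>
    intro i v hv h
    choose w hw e e' using fun n => exists_name_value hX hv (t n)
    simp only [Formula.Realize, e] at h
    obtain ⟨k, hk, h⟩ := limStruc_rel hX hw h
    refine ⟨k, hk, ?_⟩
    simpa only [Formula.Realize, e' _ k hk] using h
  | and h₁ h₂ ih₁ ih₂ =>
    intro i v hv h
    obtain ⟨k₁, hk₁, r₁⟩ := ih₁ i v hv h.1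
    obtain ⟨k₂, hk₂, r₂⟩ := ih₂ i v hv h.2
    obtain ⟨k, hk₁', hk₂'⟩ := hX k₁ k₂
    exact ⟨k, hk₁.trans hk₁', realize_of_le hk₁' h₁ (fun z => dom_mono hk₁ (hv z)) r₁,
      realize_of_le hk₂' h₂ (fun z => dom_mono hk₂ (hv z)) r₂⟩
  | or _ _ ih₁ ih₂ =>
    intro i v hv h
    rcases h with h | h
    · obtain ⟨k, hk, r⟩ := ih₁ i v hv h
      exact ⟨k, hk, Or.inl r⟩
    · obtain ⟨k, hk, r⟩ := ih₂ i v hv h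
      exact ⟨k, hk, Or.inr r⟩
  | ex z _ ih =>
    intro i v hv h
    classical
    obtain ⟨u, hu, h⟩ := Formula.realize_ex.1 h
    obtain ⟨j, hij, w, hw, e⟩ := exists_limVal_eq_above hX i (u z)
    have hu' : u = fun y => limVal hX _ (Function.update v z w y) := by
      funext y
      by_cases hy : y = z
      · subst hy
        simp [e]
      · rw [Function.update_of_ne hy, hu y hy]
    rw [hu'] at h
    obtain ⟨k, hjk, h⟩ := ih j _ (fun y => by
      by_cases hy : y = z
      · subst hy
        simpa using hw
      · rw [Function.update_of_ne hy]
        exact dom_mono hij (hv y)) h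
    refine ⟨k, hij.trans hjk, Formula.realize_ex.2 ⟨_, fun y hy => ?_, h⟩⟩
    rw [Function.update_of_ne hy]

theorem isLocalModel_limStruc (hT : IsNegativeLocalTheory T) :
    (limStruc hX).IsLocalModel T := by
  refine ⟨isLocal_limStruc hX, fun φ hφ v => ?_⟩
  obtain ⟨ψ, hψ, rfl⟩ := hT.isNegative φ hφ
  intro h
  obtain ⟨i⟩ := ‹Nonempty ι›
  -- The values of `v` need not all be named at one stage; for a sentence `v` may be replaced by an
  -- assignment that is.
  choose w hw _ using fun z : L.Var =>
    (X i).exists_name z.1 ((X i).str.nonempty_carrier z.1).some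
  have hfree : ψ.freeVars = ∅ := hT.isSentence (.neg ψ) hφ
  have h' := (ψ.realize_congr v (fun z => limVal hX _ (w z)) (by simp [hfree])).1 h
  obtain ⟨k, -, hk⟩ := exists_realize_of_limStruc hX hψ i w hw h'
  exact (X k).isLocalModel.2 _ hφ _ hk

/-- Directed families of named local models have upper bounds. -/
theorem exists_limit (hT : IsNegativeLocalTheory T) (hX : Directed (· ≤ ·) X) :
    ∃ m : Named L T W, (∀ i, X i ≤ m) ∧ ∀ s, m.dom s = ⋃ i, (X i).dom s := by
  refine ⟨⟨limStruc hX, isLocalModel_limStruc hX hT, fun s => ⋃ i, (X i).dom s, limVal hX,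
    fun s a => ?_⟩, fun i => ⟨fun s => Set.subset_iUnion_of_subset i subset_rfl, ?_⟩, fun s => rfl⟩
  · obtain ⟨i, w, hw, e⟩ := exists_limVal_eq hX a
    exact ⟨w, Set.mem_iUnion.2 ⟨i, hw⟩, e⟩
  · obtain ⟨f, hf⟩ := exists_hom_of_facts (K := fun s => (X i).dom s) (A := (X i).str)
      (C := limStruc hX) (q := fun s w => (X i).val s w) (q' := fun s w => limVal hX s w)
      (fun s a => by
        obtain ⟨w, hw, e⟩ := (X i).exists_name s a
        exact ⟨⟨w, hw⟩, e⟩)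
      (fun F hF => by
        cases F with
        | const c a => exact limStruc_const hX c a.2 hF
        | loc d a b => exact ⟨i, a, b, a.2, b.2, rfl, rfl, hF⟩
        | rel r x => exact ⟨i, fun k => x k, fun k => (x k).2, fun _ => rfl, hF⟩)
    exact ⟨f, fun s w hw => hf s ⟨w, hw⟩⟩

end Limit

end Named

/-! ### One-step extensions -/

theorem Hom.IsEmbedding.injective {A B : L.Struc} {f : Hom A B} (hf : f.IsEmbedding)
    {s : L.Sorts} {a b : A.carrier s} (h : f.toFun a = f.toFun b) : a = b :=
  (A.locMap_one _ _).1 (hf.loc 1 a b ((B.locMap_one _ _).2 h))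

theorem Hom.IsEmbedding.holds {K : L.Sorts → Type u} {A B : L.Struc} {f : Hom A B}
    (hf : f.IsEmbedding) {q : ∀ s, K s → A.carrier s} {F : Fact L K}
    (h : F.Holds B fun s a => f.toFun (q s a)) : F.Holds A q := by
  cases F with
  | const c a => exact hf.injective ((f.map_const c).trans h)
  | loc d a b => exact hf.loc d _ _ h
  | rel r x => exact hf.rel r _ h

theorem exists_range_superset {α K : Type u} [Nonempty α] [Infinite K] {S : Set α}
    (hS : S.Finite) : ∃ q : K → α, S ⊆ Set.range q := by
  obtain ⟨f, hf⟩ := (hS.insert (Classical.arbitrary α)).countable.exists_eq_range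
    (Set.insert_nonempty _ _)
  refine ⟨f ∘ Function.invFun (Infinite.natEmbedding K), fun a ha => ?_⟩
  obtain ⟨n, hn⟩ : a ∈ Set.range f := hf ▸ Set.mem_insert_of_mem _ ha
  exact ⟨Infinite.natEmbedding K n, by
    simp [Function.leftInverse_invFun (Infinite.natEmbedding K).injective n, hn]⟩

namespace Named

variable {T : Set L.Formula} {W K : Type u}

/-- Naming the elements of the substructure of `C` generated by the image of `x` and the range
of `q`. -/
theorem exists_extension (hT : IsNegativeLocalTheory T) (x : Named L T W) {C : L.Struc}
    (hC : C.IsLocalModel T) (h : Hom x.str C) {new : K → W} (hnew : Function.Injective new)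
    (hfresh : ∀ s k, new k ∉ x.dom s) (q : ∀ s, K → C.carrier s) :
    ∃ y : Named L T W, x ≤ y ∧ (∀ s, y.dom s = x.dom s ∪ Set.range new) ∧
      ∃ f : Hom y.str C, f.IsEmbedding ∧
        (∀ s, ∀ w ∈ x.dom s, f.toFun (y.val s w) = h.toFun (x.val s w)) ∧
        ∀ s k, ∃ b, f.toFun b = q s k := by
  classical
  let D : ∀ s, Set (C.carrier s) := fun s =>
    Set.range (fun a : x.str.carrier s => h.toFun a) ∪ Set.range (q s)
  have hD : ∀ s, (D s).Nonempty := fun s =>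
    (x.str.nonempty_carrier s).elim fun a => ⟨_, Or.inl ⟨a, rfl⟩⟩
  have hc : ∀ {s : L.Sorts} (c : L.Const s), C.constMap c ∈ D s := fun c =>
    Or.inl ⟨x.str.constMap c, h.map_const c⟩
  let Y := C.induced D hD hc
  have hval : ∀ s w, ∃ b : Y.carrier s, (w ∈ x.dom s → b.1 = h.toFun (x.val s w)) ∧
      ∀ k, new k = w → b.1 = q s k := by
    intro s w
    by_cases hw : w ∈ x.dom s
    · exact ⟨⟨_, Or.inl ⟨x.val s w, rfl⟩⟩, fun _ => rfl,
        fun k hk => (hfresh s k (hk ▸ hw)).elim⟩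
    · by_cases hk : ∃ k, new k = w
      · obtain ⟨k, rfl⟩ := hk
        exact ⟨⟨_, Or.inr ⟨k, rfl⟩⟩, fun h => (hw h).elim, fun k' hk' => by rw [hnew hk']⟩
      · exact ⟨(Y.nonempty_carrier s).some, fun h => (hw h).elim, fun k h => (hk ⟨k, h⟩).elim⟩
  choose val hval₁ hval₂ using hval
  have hf : (C.inducedIncl D hD hc).IsEmbedding := C.inducedIncl_isEmbedding D hD hc
  refine ⟨⟨Y, (hC.1.of_isEmbedding hf).isLocalModel hT (C.inducedIncl D hD hc) hC,
    fun s => x.dom s ∪ Set.range new, val, ?_⟩, ⟨fun s => Set.subset_union_left,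
    ⟨fun a => ⟨h.toFun a, Or.inl ⟨a, rfl⟩⟩, fun c => Subtype.ext (h.map_const c),
      fun r x hx => h.map_rel r x hx, fun d a b hd => h.map_loc d a b hd⟩,
    fun s w hw => Subtype.ext (hval₁ s w hw).symm⟩, fun s => rfl, C.inducedIncl D hD hc, hf,
    hval₁, fun s k => ⟨⟨_, Or.inr ⟨k, rfl⟩⟩, rfl⟩⟩
  rintro s ⟨b, ⟨a, rfl⟩ | ⟨k, rfl⟩⟩
  · obtain ⟨w, hw, rfl⟩ := x.exists_name s a
    exact ⟨w, Or.inl hw, Subtype.ext (hval₁ s w hw)⟩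
  · exact ⟨new k, Or.inr ⟨k, rfl⟩, Subtype.ext (hval₂ s _ k rfl)⟩

/-- If the formula `φ` about elements named in `x` can be made true in a local model of `T` over
`y`, then it is true in `y`. -/
def Decides (φ : L.Formula) (v : L.Var → W) (x y : Named L T W) : Prop :=
  φ.IsPositive → (∀ z, v z ∈ x.dom z.1) →
    (∃ C : L.Struc, C.IsLocalModel T ∧ ∃ h : Hom y.str C,
      φ.Realize C fun z => h.toFun (y.val _ (v z))) →
    φ.Realize y.str fun z => y.val _ (v z)

/-- If `φ` can be made true over `x` in some `C`, the image of `x` in `C` together with finitely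
many witnesses works. Otherwise `x` itself works, the premise being false. -/
theorem exists_decides [Infinite K] (hT : IsNegativeLocalTheory T) (φ : L.Formula)
    (v : L.Var → W) (x : Named L T W) {new : K → W} (hnew : Function.Injective new)
    (hfresh : ∀ s k, new k ∉ x.dom s) :
    ∃ y : Named L T W, x ≤ y ∧ (∀ s, y.dom s ⊆ x.dom s ∪ Set.range new) ∧ Decides φ v x y := by
  by_cases H : φ.IsPositive ∧ (∀ z, v z ∈ x.dom z.1) ∧ ∃ C : L.Struc, C.IsLocalModel T ∧
    ∃ h : Hom x.str C, φ.Realize C fun z => h.toFun (x.val _ (v z))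
  · obtain ⟨hφ, hv, C, hC, h, hr⟩ := H
    obtain ⟨F, hF, hF'⟩ := hφ.exists_finite_witnesses _ hr
    have hq : ∀ s, ∃ q : K → C.carrier s, {a | (⟨s, a⟩ : Σ s, C.carrier s) ∈ F} ⊆ Set.range q := by
      intro s
      have := C.nonempty_carrier s
      exact exists_range_superset (hF.preimage (sigma_mk_injective.injOn))
    choose q hq using hq
    obtain ⟨y, hxy, hdom, f, hf, hf₁, hf₂⟩ := exists_extension hT x hC h hnew hfresh q
    refine ⟨y, hxy, fun s => (hdom s).le, fun _ _ _ => hF' _ f hf ?_ _ fun z => hf₁ _ _ (hv z)⟩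
    rintro ⟨s, a⟩ ha
    obtain ⟨k, rfl⟩ := hq s ha
    exact hf₂ s k
  · exact ⟨x, le_rfl, fun s => Set.subset_union_left, fun h₁ h₂ h₃ => (H ⟨h₁, h₂, h₃⟩).elim⟩

/-- If the facts `Φ` hold in a local model of `T` which is compatible with `y` over the parameters
`f`, `g`, then they can be satisfied in `y` over these parameters. -/
def Absorbs (f : L.Sorts → K → W) (g : L.Sorts → K → K) (Φ : Set (Fact L fun _ => K))
    (x y : Named L T W) : Prop :=
  (∀ s k, f s k ∈ x.dom s) →
    (∃ B : L.Struc, B.IsLocalModel T ∧ ∃ q : ∀ s, K → B.carrier s, (∀ F ∈ Φ, F.Holds B q) ∧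
      ∀ φ : L.Formula, φ.IsPositive → ∀ v : L.Var → K,
        φ.Realize y.str (fun z => y.val _ (f z.1 (v z))) →
          φ.Realize B fun z => q _ (g z.1 (v z))) →
    ∃ k : ∀ s, K → y.str.carrier s, (∀ F ∈ Φ, F.Holds y.str k) ∧
      ∀ s a, k s (g s a) = y.val s (f s a)

/-- If some `B` is compatible with `x`, amalgamate and keep only the images of `x` and of the named
elements of `B`. Otherwise take `y = x`, for which the premise fails. -/
theorem exists_absorbs [Nonempty K] (hT : IsNegativeLocalTheory T) (f : L.Sorts → K → W)
    (g : L.Sorts → K → K) (Φ : Set (Fact L fun _ => K)) (x : Named L T W) {new : K → W}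
    (hnew : Function.Injective new) (hfresh : ∀ s k, new k ∉ x.dom s) :
    ∃ y : Named L T W, x ≤ y ∧ (∀ s, y.dom s ⊆ x.dom s ∪ Set.range new) ∧ Absorbs f g Φ x y := by
  by_cases H : (∀ s k, f s k ∈ x.dom s) ∧
    ∃ B : L.Struc, B.IsLocalModel T ∧ ∃ q : ∀ s, K → B.carrier s, (∀ F ∈ Φ, F.Holds B q) ∧
      ∀ φ : L.Formula, φ.IsPositive → ∀ v : L.Var → K,
        φ.Realize x.str (fun z => x.val _ (f z.1 (v z))) →
          φ.Realize B fun z => q _ (g z.1 (v z))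
  · obtain ⟨hdf, B, hB, q, hΦ, hφ⟩ := H
    obtain ⟨C, hC, h, k, hk⟩ := exists_amalgam (K := fun _ => K) hT x.isLocalModel.1 hB
      (fun _ => ‹_›) (f := fun s a => x.val s (f s a)) (g := fun s a => q s (g s a)) hφ
    obtain ⟨y, hxy, hdom, e, he, he₁, he₂⟩ :=
      exists_extension hT x hC h hnew hfresh fun s a => k.toFun (q s a)
    choose b hb using he₂
    refine ⟨y, hxy, fun s => (hdom s).le, fun _ _ => ⟨b, fun F hF => he.holds ?_, fun s a => ?_⟩⟩
    · simp only [hb]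
      exact k.holds (hΦ F hF)
    · refine he.injective ?_
      rw [hb, he₁ s _ (hdf s a), hk]
  · exact ⟨x, le_rfl, fun s => Set.subset_union_left, fun h₁ h₂ => (H ⟨h₁, h₂⟩).elim⟩

end Named

/-! ### Transfinite chains -/

/-- Transfinite recursion along a well-order in a preorder. -/
theorem exists_transfinite_chain {Q : Type*} [Preorder Q] {θ : Type*} [LinearOrder θ]
    [WellFoundedLT θ] (x₀ : Q) (P : θ → Q → Prop) (R : θ → Q → Q → Prop)
    (step : ∀ (i : θ) (g : θ → Q), MonotoneOn g (Set.Iio i) → (∀ j < i, x₀ ≤ g j ∧ P j (g j)) →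
      ∃ y, x₀ ≤ y ∧ (∀ j < i, g j ≤ y) ∧ P i y ∧ ∃ x, (∀ j < i, g j ≤ x) ∧ R i x y) :
    ∃ g : θ → Q, Monotone g ∧ ∀ i, x₀ ≤ g i ∧ P i (g i) ∧ ∃ x, (∀ j < i, g j ≤ x) ∧ R i x (g i) := by
  classical
  let Good : ∀ i : θ, (∀ j, j < i → Q) → Q → Prop := fun i g y =>
    x₀ ≤ y ∧ (∀ j (hj : j < i), g j hj ≤ y) ∧ P i y ∧ ∃ x, (∀ j (hj : j < i), g j hj ≤ x) ∧ R i x y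
  let G : ∀ i : θ, (∀ j, j < i → Q) → Q := fun i g =>
    if h : ∃ y, Good i g y then h.choose else x₀
  let g : θ → Q := (wellFounded_lt (α := θ)).fix G
  have hg : ∀ i, g i = G i fun j _ => g j := fun i => WellFounded.fix_eq _ _ _
  have good : ∀ i, Good i (fun j _ => g j) (g i) := by
    intro i
    induction i using WellFoundedLT.induction with
    | _ i ih =>
    have hmono : MonotoneOn g (Set.Iio i) := by
      intro j _ k hk hjk
      rcases hjk.eq_or_lt with rfl | hjk
      · exact le_rfl
      · exact (ih k hk).2.1 j hjk
    have h : ∃ y, Good i (fun j _ => g j) y :=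
      step i g hmono fun j hj => ⟨(ih j hj).1, (ih j hj).2.2.1⟩
    rw [hg i]
    simp only [G, dif_pos h]
    exact h.choose_spec
  refine ⟨g, fun j k hjk => ?_, fun i => ⟨(good i).1, (good i).2.2⟩⟩
  rcases hjk.eq_or_lt with rfl | hjk
  · exact le_rfl
  · exact (good k).2.1 j hjk

/-- A chain of named local models which starts with `x₀`; the names added in the `i`-th step are
those with label `i`. -/
theorem Named.exists_chain {T : Set L.Formula} (hT : IsNegativeLocalTheory T) {θ K : Type u}
    [LinearOrder θ] [WellFoundedLT θ] (x₀ : Named L T (Option θ × K))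
    (hx₀ : ∀ s, ∀ w ∈ x₀.dom s, w.1 = none)
    (R : θ → Named L T (Option θ × K) → Named L T (Option θ × K) → Prop)
    (hR : ∀ i x, (∀ s k, ((some i, k) : Option θ × K) ∉ x.dom s) → ∃ y, x ≤ y ∧
      (∀ s, y.dom s ⊆ x.dom s ∪ Set.range fun k => (some i, k)) ∧ R i x y) :
    ∃ g : θ → Named L T (Option θ × K), Monotone g ∧
      ∀ i, x₀ ≤ g i ∧ ∃ x, (∀ j < i, g j ≤ x) ∧ R i x (g i) := by
  obtain ⟨g, hg, h⟩ := exists_transfinite_chain (θ := θ) x₀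
    -- Labels at stage `i` are at most `i`, so those below are less than `i` and the names labelled
    -- `i` are fresh.
    (fun i x => ∀ s, ∀ w ∈ x.dom s, ∀ j, w.1 = some j → j ≤ i) R (by
      intro i g hmono hg
      -- The extra index `none` carries `x₀`, so the family is nonempty even at the bottom of `θ`.
      let X : Option (Set.Iio i) → Named L T (Option θ × K) := fun o => o.elim x₀ fun j => g j
      have hX : Directed (· ≤ ·) X := by
        rintro (_ | j) (_ | k)
        · exact ⟨none, le_rfl, le_rfl⟩
        · exact ⟨some k, (hg k k.2).1, le_rfl⟩
        · exact ⟨some j, le_rfl, (hg j j.2).1⟩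
        · rcases le_total j k with hjk | hjk
          · exact ⟨some k, hmono j.2 k.2 hjk, le_rfl⟩
          · exact ⟨some j, le_rfl, hmono k.2 j.2 hjk⟩
      obtain ⟨x, hx, hdom⟩ := exists_limit hT hX
      have hlt : ∀ s, ∀ w ∈ x.dom s, ∀ j, w.1 = some j → j < i := by
        intro s w hw j hj
        rw [hdom s] at hw
        obtain ⟨_ | k, hw⟩ := Set.mem_iUnion.1 hw
        · simp [hx₀ s w hw] at hj
        · exact ((hg k k.2).2 s w hw j hj).trans_lt k.2
      obtain ⟨y, hxy, hy, hRy⟩ := hR i x fun s k hk => lt_irrefl i (hlt s _ hk i rfl)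
      refine ⟨y, (hx none).trans hxy, fun j hj => (hx (some ⟨j, hj⟩)).trans hxy, ?_, x,
        fun j hj => hx (some ⟨j, hj⟩), hRy⟩
      intro s w hw j hj
      rcases hy s hw with hw | ⟨k, rfl⟩
      · exact (hlt s w hw j hj).le
      · exact (Option.some.inj hj).ge)
  exact ⟨g, hg, fun i => ⟨(h i).1, (h i).2.2⟩⟩

/-! ### Cardinalities -/

section Card

variable {κ : Cardinal.{u}}

theorem mk_sorts_le (hL : L.card ≤ κ) : #L.Sorts ≤ κ := by
  refine le_trans (mk_le_of_injective (f := fun s => Sum.inr (Sum.inr ⟨s, 1⟩)) ?_) hL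
  intro s s' h
  simp only [Sum.inr.injEq, Sigma.mk.injEq] at h
  exact h.1

theorem mk_const_le (hL : L.card ≤ κ) : #(Σ s, L.Const s) ≤ κ :=
  le_trans (mk_le_of_injective Sum.inl_injective) hL

theorem mk_rel_le (hL : L.card ≤ κ) : #(Σ l, L.Rel l) ≤ κ :=
  le_trans (mk_le_of_injective (Sum.inr_injective.comp Sum.inl_injective)) hL

theorem mk_loc_le (hL : L.card ≤ κ) : #(Σ s, L.Loc s) ≤ κ :=
  le_trans (mk_le_of_injective (Sum.inr_injective.comp Sum.inr_injective)) hL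

theorem mk_fact_le (hκ : ℵ₀ ≤ κ) (hL : L.card ≤ κ) {K : L.Sorts → Type u}
    (hK : #(Σ s, K s) ≤ κ) : #(Fact L K) ≤ κ := by
  let e : Fact L K → (Σ s, L.Const s) × (Σ s, K s) ⊕
      ((Σ s, L.Loc s) × (Σ s, K s) × (Σ s, K s)) ⊕ (Σ l, L.Rel l) × List (Σ s, K s) := fun F =>
    match F with
    | .const c a => .inl (⟨_, c⟩, ⟨_, a⟩)
    | .loc d a b => .inr (.inl (⟨_, d⟩, ⟨_, a⟩, ⟨_, b⟩))
    | .rel r x => .inr (.inr (⟨_, r⟩, List.ofFn fun i => ⟨_, x i⟩))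
  have he : Function.Injective e := by
    rintro (⟨c, a⟩ | ⟨d, a, b⟩ | ⟨r, x⟩) (⟨c', a'⟩ | ⟨d', a', b'⟩ | ⟨r', x'⟩) h <;>
      simp only [e, Sum.inl.injEq, Sum.inr.injEq, Prod.mk.injEq, reduceCtorEq] at h
    · obtain ⟨h₁, h₂⟩ := h
      cases h₁
      cases h₂
      rfl
    · obtain ⟨h₁, h₂, h₃⟩ := h
      cases h₁
      cases h₂
      cases h₃
      rfl
    · obtain ⟨h₁, h₂⟩ := h
      cases h₁
      have h₃ := List.ofFn_injective h₂
      obtain rfl : x = x' := funext fun i => by simpa using congrFun h₃ i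
      rfl
  refine (mk_le_of_injective he).trans ?_
  simp only [mk_sum, mk_prod, lift_id]
  have hList : #(List (Σ s, K s)) ≤ κ := (mk_list_le_max _).trans (max_le hκ hK)
  exact add_le_of_le hκ (mul_le_of_le hκ (mk_const_le hL) hK)
    (add_le_of_le hκ (mul_le_of_le hκ (mk_loc_le hL) (mul_le_of_le hκ hK hK))
      (mul_le_of_le hκ (mk_rel_le hL) hList))

theorem mk_term_le (hκ : ℵ₀ ≤ κ) (hL : L.card ≤ κ) : #(Σ s, L.Term s) ≤ κ := by
  let e : (L.Sorts × ℕ) ⊕ (Σ s, L.Const s) → Σ s, L.Term s :=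
    Sum.elim (fun p => ⟨p.1, .var p.2⟩) fun p => ⟨p.1, .const p.2⟩
  have he : Function.Surjective e := by
    rintro ⟨s, n | c⟩
    · exact ⟨.inl (s, n), rfl⟩
    · exact ⟨.inr ⟨s, c⟩, rfl⟩
  refine (mk_le_of_surjective he).trans ?_
  simp only [mk_sum, mk_prod, lift_id, lift_uzero, mk_nat, lift_aleph0]
  exact add_le_of_le hκ (mul_le_of_le hκ (mk_sorts_le hL) hκ) (mk_const_le hL)

theorem mk_var_le (hκ : ℵ₀ ≤ κ) (hL : L.card ≤ κ) : #L.Var ≤ κ := by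
  simp only [Var, mk_prod, lift_uzero, mk_nat, lift_aleph0]
  exact mul_le_of_le hκ (mk_sorts_le hL) hκ

/-- Formulas are the image of a W-type with finite branching whose leaves are facts about terms. The
`const` facts are redundant codes for equalities, so the coding is only surjective. -/
theorem mk_formula_le (hκ : ℵ₀ ≤ κ) (hL : L.card ≤ κ) : #L.Formula ≤ κ := by
  let β : Fact L L.Term ⊕ Unit ⊕ Bool ⊕ L.Var → Type := fun a =>
    match a with
    | .inl _ => Empty
    | .inr (.inl _) => Unit
    | .inr (.inr (.inl _)) => Bool
    | .inr (.inr (.inr _)) => Unit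
  let dec : WType β → L.Formula := WType.elim _ fun a =>
    match a with
    | ⟨.inl (.const c t), _⟩ => .loc 1 (.const c) t
    | ⟨.inl (.loc d t₁ t₂), _⟩ => .loc d t₁ t₂
    | ⟨.inl (.rel r t), _⟩ => .rel r t
    | ⟨.inr (.inl _), f⟩ => .neg (f ())
    | ⟨.inr (.inr (.inl true)), f⟩ => .and (f true) (f false)
    | ⟨.inr (.inr (.inl false)), f⟩ => .or (f true) (f false)
    | ⟨.inr (.inr (.inr x)), f⟩ => .ex x (f ())
  have hdec : Function.Surjective dec := by
    intro φ
    induction φ with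
    | loc d t₁ t₂ => exact ⟨⟨.inl (.loc d t₁ t₂), Empty.elim⟩, rfl⟩
    | rel r t => exact ⟨⟨.inl (.rel r t), Empty.elim⟩, rfl⟩
    | neg φ ih =>
      obtain ⟨w, rfl⟩ := ih
      exact ⟨⟨.inr (.inl ()), fun _ => w⟩, rfl⟩
    | and φ ψ ih₁ ih₂ =>
      obtain ⟨w₁, rfl⟩ := ih₁
      obtain ⟨w₂, rfl⟩ := ih₂
      exact ⟨⟨.inr (.inr (.inl true)), fun b : Bool => if b then w₁ else w₂⟩, rfl⟩
    | or φ ψ ih₁ ih₂ =>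
      obtain ⟨w₁, rfl⟩ := ih₁
      obtain ⟨w₂, rfl⟩ := ih₂
      exact ⟨⟨.inr (.inr (.inl false)), fun b : Bool => if b then w₁ else w₂⟩, rfl⟩
    | ex x φ ih =>
      obtain ⟨w, rfl⟩ := ih
      exact ⟨⟨.inr (.inr (.inr x)), fun _ => w⟩, rfl⟩
  have : ∀ a, Finite (β a) := by
    rintro (a | a | a | a) <;> simp only [β] <;> infer_instance
  refine (mk_le_of_surjective hdec).trans (WType.cardinalMk_le_max_aleph0_of_finite'.trans ?_)
  refine max_le ?_ hκ
  have h1 : (1 : Cardinal.{u}) ≤ κ := one_le_aleph0.trans hκ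
  have h2 : (2 : Cardinal.{u}) ≤ κ := (natCast_lt_aleph0 (n := 2)).le.trans hκ
  simp only [mk_sum, lift_id, lift_uzero, mk_fintype, Fintype.card_unit,
    Fintype.card_bool, Nat.cast_one, Nat.cast_ofNat, lift_one, lift_ofNat]
  exact add_le_of_le hκ (mk_fact_le hκ hL (mk_term_le hκ hL))
    (add_le_of_le hκ h1 (add_le_of_le hκ h2 (mk_var_le hκ hL)))

theorem mk_fun_le_two_power (hκ : ℵ₀ ≤ κ) {α β : Type u} (hα : #α ≤ κ) (hβ : #β ≤ 2 ^ κ) :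
    #(α → β) ≤ 2 ^ κ := by
  rw [← power_def]
  calc #β ^ #α ≤ (2 ^ κ) ^ #α := power_le_power_right hβ
    _ = 2 ^ (κ * #α) := (power_mul).symm
    _ ≤ 2 ^ κ := power_le_power_left two_ne_zero (mul_le_of_le hκ le_rfl hα)

theorem exists_surjective_of_mk_le {α K : Type u} [Nonempty α] (h : #α ≤ #K) :
    ∃ q : K → α, Function.Surjective q := by
  obtain ⟨f⟩ := h
  exact ⟨Function.invFun f, Function.invFun_surjective f.injective⟩

/-- A well-order of type `2 ^ κ` in which subsets of size `κ` are bounded, with an enumeration of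
any small enough set in which each element occurs arbitrarily late. -/
theorem exists_index (hκ : ℵ₀ ≤ κ) {P : Type u → Type u} (hP : ∀ θ : Type u, #θ ≤ 2 ^ κ →
      #(P θ) ≤ 2 ^ κ) (hP₀ : ∀ θ, Nonempty (P θ)) :
    ∃ (θ : Type u) (_ : LinearOrder θ), WellFoundedLT θ ∧ Nonempty θ ∧ #θ ≤ 2 ^ κ ∧
      (∀ (α : Type u) (f : α → θ), #α ≤ κ → ∃ j, ∀ a, f a ≤ j) ∧
      ∃ p : θ → P θ, ∀ a j, ∃ i, j < i ∧ p i = a := by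
  have hlam : ℵ₀ ≤ 2 ^ κ := hκ.trans (cantor κ).le
  let θ := ((2 : Cardinal.{u}) ^ κ).ord.ToType
  have hθ : #θ = 2 ^ κ := by simp [θ]
  have hne : Nonempty θ := mk_ne_zero_iff.1 (hθ ▸ (aleph0_pos.trans_le hlam).ne')
  refine ⟨θ, inferInstance, inferInstance, hne, hθ.le, fun α f hα => ?_, ?_⟩
  · by_contra! H
    have hcof : IsCofinal (Set.range f) := fun j => by
      obtain ⟨a, ha⟩ := H j
      exact ⟨f a, ⟨a, rfl⟩, ha.le⟩
    -- An unbounded family of size `κ` would contradict König's theorem on the cofinality of `2 ^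
    -- κ`.
    have h₁ : Order.cof θ ≤ κ := (Order.cof_le hcof).trans (mk_range_le.trans hα)
    rw [Ordinal.cof_toType] at h₁
    exact (h₁.trans_lt (lt_cof_ord_power hκ one_lt_two)).false
  · have hle : #(θ × P θ) = #θ := by
      have := hP₀ θ
      rw [mk_prod, lift_id, lift_id, hθ]
      exact mul_eq_left hlam (hP θ hθ.le) (mk_ne_zero _)
    obtain ⟨e⟩ := Cardinal.eq.1 hle
    -- Each fibre of this enumeration has the size of `θ`, whereas proper initial segments are
    -- smaller; so no fibre is bounded.
    refine ⟨fun i => (e.symm i).2, fun a j => ?_⟩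
    by_contra! H
    have h₁ : #θ ≤ #(Set.Iic j) := mk_le_of_injective
      (f := fun i => (⟨e (i, a), not_lt.1 fun h => H _ h (by simp)⟩ : Set.Iic j)) fun i i' h =>
        congrArg Prod.fst (e.injective (Subtype.ext_iff.1 h))
    exact (h₁.trans_lt (mk_Iic_lt j (by simp [θ]) (hθ ▸ hlam))).false

end Card

/-! ### Bookkeeping and the main construction -/

/-- The extension problems over the elements named by `W`: formulas to be decided, and structures
given by the facts about names in `K` to be absorbed. -/
abbrev Problem (L : LocalLanguage.{u}) (K W : Type u) : Type u :=
  (L.Formula × (L.Var → W)) ⊕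
    ((L.Sorts → K → W) × (L.Sorts → K → K) × Set (Fact L fun _ => K))

/-- `p.Solves x y`: the extension problem `p` over `x` is solved in `y`. -/
def Problem.Solves {T : Set L.Formula} {K W : Type u} : Problem L K W →
    Named L T W → Named L T W → Prop
  | .inl (φ, v), x, y => Named.Decides φ v x y
  | .inr (f, g, Φ), x, y => Named.Absorbs f g Φ x y

theorem mk_problem_le {κ : Cardinal.{u}} (hκ : ℵ₀ ≤ κ) (hL : L.card ≤ κ) {K W : Type u}
    (hK : #K ≤ κ) (hW : #W ≤ 2 ^ κ) : #(Problem L K W) ≤ 2 ^ κ := by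
  have hlam : ℵ₀ ≤ 2 ^ κ := hκ.trans (cantor κ).le
  have hSK : #(Σ _ : L.Sorts, K) ≤ κ := by
    rw [mk_congr (Equiv.sigmaEquivProd _ _), mk_prod, lift_id, lift_id]
    exact mul_le_of_le hκ (mk_sorts_le hL) hK
  have hΦ : #(Set (Fact L fun _ => K)) ≤ 2 ^ κ := by
    rw [mk_set]
    exact power_le_power_left two_ne_zero (mk_fact_le hκ hL hSK)
  have hf : ∀ {β : Type u}, #β ≤ 2 ^ κ → #(L.Sorts → K → β) ≤ 2 ^ κ := fun hβ =>
    mk_fun_le_two_power hκ (mk_sorts_le hL) (mk_fun_le_two_power hκ hK hβ)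
  simp only [mk_sum, mk_prod, lift_id]
  exact add_le_of_le hlam
    (mul_le_of_le hlam ((mk_formula_le hκ hL).trans (cantor κ).le)
      (mk_fun_le_two_power hκ (mk_var_le hκ hL) hW))
    (mul_le_of_le hlam (hf hW) (mul_le_of_le hlam (hf (hK.trans (cantor κ).le)) hΦ))

theorem Struc.mk_carrier_le (M : L.Struc) (s : L.Sorts) : #(M.carrier s) ≤ M.card :=
  mk_le_of_injective (sigma_mk_injective (i := s))

/-- The main construction, when `κ` bounds the sizes of `L` and of the given model. -/
theorem exists_ultrahomogeneous {T : Set L.Formula} (hT : IsNegativeLocalTheory T)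
    {κ : Cardinal.{u}} (hκ : ℵ₀ ≤ κ) (hL : L.card ≤ κ) (N : L.Struc) (hN : N.IsLocalModel T)
    (hNκ : N.card ≤ κ) :
    ∃ M : L.Struc, M.IsLocalPCModel T ∧ M.IsUltrahomogeneous T κ ∧ Nonempty (Hom N M) ∧
      M.card ≤ 2 ^ κ := by
  have hlam : ℵ₀ ≤ 2 ^ κ := hκ.trans (cantor κ).le
  let K : Type u := κ.out
  have hK : #K = κ := mk_out κ
  have : Infinite K := infinite_iff.2 (hK ▸ hκ)
  have hW : ∀ θ : Type u, #θ ≤ 2 ^ κ → #(Option θ × K) ≤ 2 ^ κ := fun θ hθ => by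
    rw [mk_prod, lift_id, lift_id, mk_option, hK]
    exact mul_le_of_le hlam (add_le_of_le hlam hθ (one_le_aleph0.trans hlam)) (cantor κ).le
  obtain ⟨θ, _, _, hne, hθ, hbdd, p, hp⟩ := exists_index hκ
    (P := fun θ => Problem L K (Option θ × K)) (fun θ hθ => mk_problem_le hκ hL hK.le (hW θ hθ))
    fun θ => ⟨.inr (fun _ k => (none, k), fun _ k => k, ∅)⟩
  have hsurj : ∀ {A : L.Struc}, A.card ≤ κ → ∀ s, ∃ q : K → A.carrier s, Function.Surjective q := by
    intro A hA s
    have := A.nonempty_carrier s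
    exact exists_surjective_of_mk_le ((A.mk_carrier_le s).trans (hA.trans hK.ge))
  choose q hq using hsurj hNκ
  let x₀ : Named L T (Option θ × K) :=
    ⟨N, hN, fun _ => {w | w.1 = none}, fun s w => q s w.2, fun s a =>
      (hq s a).elim fun k hk => ⟨(none, k), rfl, hk⟩⟩
  obtain ⟨g, hg, hg'⟩ := Named.exists_chain hT x₀ (fun _ _ h => h)
    (fun i => Problem.Solves (p i)) (by
      intro i x hx
      have hinj : Function.Injective fun k : K => ((some i, k) : Option θ × K) :=
        fun k k' h => (Prod.ext_iff.1 h).2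
      rcases p i with ⟨φ, v⟩ | ⟨f, g, Φ⟩
      · exact Named.exists_decides hT φ v x hinj hx
      · exact Named.exists_absorbs hT f g Φ x hinj hx)
  obtain ⟨m, hm, hdom⟩ := Named.exists_limit hT hg.directed_le
  -- The point of the cofinality: at most `κ` names of the limit all occur by some stage `j₀`, and
  -- every problem is posed after `j₀`.
  have late : ∀ {α : Type u} (s : α → L.Sorts) (w : α → Option θ × K), #α ≤ κ →
      (∀ a, w a ∈ m.dom (s a)) → ∀ P : Problem L K (Option θ × K),
      ∃ i x, (∀ a, w a ∈ x.dom (s a)) ∧ (∀ a, w a ∈ (g i).dom (s a)) ∧ P.Solves x (g i) := by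
    intro α s w hα hw P
    choose j hj using fun a => Set.mem_iUnion.1 (hdom (s a) ▸ hw a)
    obtain ⟨j₀, hj₀⟩ := hbdd α j hα
    obtain ⟨i, hi, rfl⟩ := hp P j₀
    obtain ⟨-, x, hx, hs⟩ := hg' i
    exact ⟨i, x, fun a => Named.dom_mono ((hg (hj₀ a)).trans (hx j₀ hi)) (hj a),
      fun a => Named.dom_mono (hg ((hj₀ a).trans hi.le)) (hj a), hs⟩
  refine ⟨m.str, ⟨m.isLocalModel, fun C hC f φ hφ v hr => ?_⟩, ⟨m.isLocalModel, ?_⟩, ?_, ?_⟩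
  · choose w hw hwv using fun z : L.Var => m.exists_name z.1 (v z)
    obtain rfl : (fun z : L.Var => m.val z.1 (w z)) = v := funext hwv
    -- There are at most `κ` variables, so the whole assignment is named at one stage. A model above
    -- the limit also lies above that stage, where `φ` is then already true.
    obtain ⟨i, x, hx, hi, hs⟩ := late (fun z : L.Var => z.1) w (mk_var_le hκ hL) hw (.inl (φ, w))
    obtain ⟨e, he⟩ := Named.exists_hom_of_le (hm i)
    refine Named.realize_of_le (hm i) hφ hi (hs hφ hx ⟨C, hC, f.comp e, ?_⟩)
    convert hr using 2 with z
    exact congrArg _ (he _ _ (hi z))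
  · intro A B f h hf hB hA hBκ
    choose α hα using hsurj hA.le
    choose β hβ using hsurj hBκ.le
    choose w hw hwf using fun (s : L.Sorts) (k : K) => m.exists_name s (f.toFun (α s k))
    choose γ hγ using fun (s : L.Sorts) (k : K) => hβ s (h.toFun (α s k))
    have hcard : #(L.Sorts × K) ≤ κ := by
      rw [mk_prod, lift_id, lift_id]
      exact mul_le_of_le hκ (mk_sorts_le hL) hK.le
    obtain ⟨i, x, hx, hi, hs⟩ := late (fun a : L.Sorts × K => a.1) (fun a => w a.1 a.2) hcard
      -- The copies of `A` in the limit and in `B` are the parameters, and `B` enters through its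
      -- atomic diagram.
      (fun a => hw _ _) (.inr (w, γ, {F | F.Holds B β}))
    obtain ⟨e, he⟩ := Named.exists_hom_of_le (hm i)
    obtain ⟨k, hk, hkw⟩ := hs (fun s a => hx (s, a)) ⟨B, hB, β, fun F hF => hF, by
      -- Compatibility: a positive formula true at stage `i` goes up to the limit, is reflected to
      -- `A` by the positive embedding, and passes on to `B`.
      intro φ hφ v hr
      have h₁ := Named.realize_of_le (hm i) hφ (fun z => hi (z.1, v z)) hr
      have h₂ := h.realize hφ (fun z => α _ (v z)) (hf φ hφ _ (by simpa only [hwf] using h₁))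
      simpa only [hγ] using h₂⟩
    obtain ⟨b, hb⟩ := exists_hom_of_facts hβ hk
    refine ⟨e.comp b, fun s a => ?_⟩
    obtain ⟨a, rfl⟩ := hα s a
    simp only [Hom.comp]
    rw [← hγ, hb, hkw, he s _ (hi (s, a)), hwf]
  · obtain ⟨i⟩ := hne
    obtain ⟨e, -⟩ := Named.exists_hom_of_le ((hg' i).1.trans (hm i))
    exact ⟨e⟩
  · have hs : Function.Surjective fun a : L.Sorts × (Option θ × K) =>
        (⟨a.1, m.val a.1 a.2⟩ : Σ s, m.str.carrier s) := by
      rintro ⟨s, a⟩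
      obtain ⟨w, -, rfl⟩ := m.exists_name s a
      exact ⟨(s, w), rfl⟩
    refine (mk_le_of_surjective hs).trans ?_
    rw [mk_prod, lift_id, lift_id]
    exact mul_le_of_le hlam ((mk_sorts_le hL).trans (cantor κ).le) (hW θ hθ)

end LocalLanguage

/-! ### The theorem for arbitrary cardinals -/

theorem mainTheorem3 (L : LocalLanguage.{u}) (T : Set L.Formula)
    (hT : LocalLanguage.IsNegativeLocalTheory T) (κ : Cardinal.{u})
    (N : L.Struc) (hN : N.IsLocalModel T) :
    ∃ M : L.Struc, M.IsLocalPCModel T ∧ M.IsUltrahomogeneous T κ ∧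
      Nonempty (LocalLanguage.Hom N M) ∧
      (Cardinal.aleph0 ≤ κ → L.card ≤ κ → N.card ≤ κ → M.card ≤ 2 ^ κ) := by
  -- Ultrahomogeneity for `μ` implies it for the smaller `κ`; under the hypotheses of the size
  -- bound, `μ = κ`.
  let μ := max κ (max ℵ₀ (max L.card N.card))
  obtain ⟨M, hM, hMμ, hNM, hcard⟩ := LocalLanguage.exists_ultrahomogeneous hT (κ := μ)
    (le_max_of_le_right (le_max_left _ _))
    (le_max_of_le_right (le_max_of_le_right (le_max_left _ _))) N hN
    (le_max_of_le_right (le_max_of_le_right (le_max_right _ _)))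
  refine ⟨M, hM, ⟨hMμ.1, fun A B f g hf hB hA hB' => hMμ.2 A B f g hf hB
    (hA.trans_le (le_max_left _ _)) (hB'.trans_le (le_max_left _ _))⟩, hNM, fun h₁ h₂ h₃ => ?_⟩
  rwa [show μ = κ from max_eq_left (max_le h₁ (max_le h₂ h₃))] at hcard
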